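/- Let $I\subset\mathbb{R}$ be an open set of parameters (for instance an open interval) and let $\{f_\mu\}_{\mu\in I}$ be a family of piecewise linear orientation preserving homeomorphisms of the circle $\mathbb{R}/\mathbb{Z}$ with lifts $F_\mu$ (continuous, strictly increasing, $F_\mu(x+1)=F_\mu(x)+1$), given by break points $b_1(\mu)<\dots<b_n(\mu)<b_{n+1}(\mu)=b_1(\mu)+1$ and values $\phi_k(\mu)=F_\mu(b_k(\mu))$, extended to all $k\in\mathbb{Z}$ by $b_{k+n}=b_k+1$, $\phi_{k+n}=\phi_k+1$: thus $$F_\mu(x)=\phi_k(\mu)+s_k(\mu)(x-b_k(\mu))\quad\text{for } x\in[b_k(\mu),b_{k+1}(\mu)),\qquad s_k=\frac{\phi_{k+1}-\phi_k}{b_{k+1}-b_k},\quad s_k(\mu)\neq s_{k-1}(\mu).$$ Assume that $b_k$ and $\phi_k$ are $C^2$ functions of $\mu\in I$. Let $\rho(F)=\lim_{m\to\infty}\frac1m(F^m(x)-x)$ be the rotation number of a lift. Let $\mu_c\in I$, $p\in\mathbb{Z}$, $q\ge1$ be such that $f_{\mu_c}$ is topologically conjugate to the rigid rotation $x\mapsto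 x+\frac pq \pmod 1$ and $\rho(F_{\mu_c})=\frac pq$, and assume the transversality condition $$\phi_k'(\mu_c)-\max\{0,\ s_{k-1}(\mu_c)b_k'(\mu_c),\ s_k(\mu_c)b_k'(\mu_c)\}>0,\qquad k=1,\dots,n.$$ Then the following hold. Let $\ell_0<\ell_1<\dots<\ell_N=\ell_0+1$ enumerate, over one period, the points $x$ for which $F_{\mu_c}^j(x)$ is a break point of $F_{\mu_c}$ for some $0\le j<q$, and put $G_\mu(x)=F_\mu^q(x)-p$. For each $0\le i<N$ there are $\gamma>0$ and constants $A_i>0$, $B_i$ (both uniquely determined) such that for $\mu$ near $\mu_c$ the map $G_\mu$ is affine on $[M_i(\mu),\,\ell_{i+1}-\gamma|\mu-\mu_c|]$, where $M_i(\mu)=\ell_i+\gamma|\mu-\mu_c|$, with slope $1+B_i(\mu-\mu_c)+O((\mu-\mu_c)^2)$, and $G_\mu(M_i(\mu))-M_i(\mu)=A_i(\mu-\mu_c)+O((\mu-\mu_c)^2)$. Moreover $1+(\ell_{i+1}-\ell_i)B_i/A_i>0$. Set $$\kappa_i=\frac1{B_i}\ln\Bigl(1+\frac{(\ell_{i+1}-\ell_i)B_i}{A_i}\Bigr)\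 \text{ if } B_i\ne0,\qquad \kappa_i=\frac{\ell_{i+1}-\ell_i}{A_i}\ \text{ if } B_i=0,\qquad R_1=\frac1{q\sum_{i=0}^{N-1}\kappa_i}.$$ Then $R_1>0$, the function $\mu\mapsto\rho(F_\mu)$ is differentiable at $\mu_c$ with derivative $R_1$, and there are an open neighbourhood $\mathcal N\subset I$ of $\mu_c$ and a constant $R_2>0$ such that $$\Bigl|\rho(F_\mu)-\frac pq-R_1(\mu-\mu_c)\Bigr|<R_2(\mu-\mu_c)^2\qquad\text{for all }\mu\in\mathcal N\setminus\{\mu_c\}.$$ -/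

import Mathlib

open Filter Topology Asymptotics

noncomputable section

/-- The circle map `f` induced by a lift `F`, i.e. `f (x mod 1) = F x mod 1`. -/
def circleMapOfLift (F : CircleDeg1Lift) : UnitAddCircle → UnitAddCircle :=
  Function.Periodic.lift (f := fun x : ℝ => ((F x : ℝ) : UnitAddCircle)) (c := (1 : ℝ))
    (fun x => by
      show ((F (x + 1) : ℝ) : UnitAddCircle) = ((F x : ℝ) : UnitAddCircle)
      rw [F.map_add_one]
      exact AddCircle.coe_add_period (1 : ℝ) (F x))

/-- `f` is topologically conjugate to the rigid rotation `x ↦ x + α (mod 1)`. -/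
def IsConjugateToRotation (f : UnitAddCircle → UnitAddCircle) (α : ℝ) : Prop :=
  ∃ h : UnitAddCircle ≃ₜ UnitAddCircle, ∀ x, h (f x) = h x + (α : UnitAddCircle)

/-- The slope `s_k(μ)` of the affine piece between the break points `b_k(μ)` and `b_{k+1}(μ)`. -/
def pieceSlope (b φ : ℤ → ℝ → ℝ) (k : ℤ) (μ : ℝ) : ℝ :=
  (φ (k + 1) μ - φ k μ) / (b (k + 1) μ - b k μ)

/-- `F μ`, `μ ∈ I`, are lifts of a family of piecewise linear orientation preserving
homeomorphisms of the circle with `n` break points `b_1(μ) < ⋯ < b_n(μ) < b_1(μ) + 1` and values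
`φ_k(μ) = F_μ(b_k(μ))` at them, which are `C²` functions of `μ`. The break points and values are
indexed by `ℤ` (all break points of the lift) through `b_{k+n} = b_k + 1`, `φ_{k+n} = φ_k + 1`.
These conditions force `2 ≤ n`. -/
structure IsPWLFamily (n : ℕ) (I : Set ℝ) (b φ : ℤ → ℝ → ℝ) (F : ℝ → CircleDeg1Lift) : Prop where
  /-- each `F μ` is the lift of an orientation preserving homeomorphism -/
  continuous_lift : ∀ μ ∈ I, Continuous (F μ)
  strictMono_lift : ∀ μ ∈ I, StrictMono (F μ)
  break_periodic : ∀ μ ∈ I, ∀ k : ℤ, b (k + n) μ = b k μ + 1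
  value_periodic : ∀ μ ∈ I, ∀ k : ℤ, φ (k + n) μ = φ k μ + 1
  break_lt : ∀ μ ∈ I, ∀ k : ℤ, b k μ < b (k + 1) μ
  /-- the slope really changes at each break point -/
  slope_ne : ∀ μ ∈ I, ∀ k : ℤ, pieceSlope b φ k μ ≠ pieceSlope b φ (k - 1) μ
  /-- the affine pieces -/
  eq_affine : ∀ μ ∈ I, ∀ k : ℤ, ∀ x ∈ Set.Ico (b k μ) (b (k + 1) μ),
    F μ x = φ k μ + pieceSlope b φ k μ * (x - b k μ)
  contDiffOn_break : ∀ k : ℤ, ContDiffOn ℝ 2 (b k) I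
  contDiffOn_value : ∀ k : ℤ, ContDiffOn ℝ 2 (φ k) I

/-- The transversality condition at `μc`:
`φ_k'(μc) - max {0, s_{k-1}(μc) b_k'(μc), s_k(μc) b_k'(μc)} > 0` for all `k`. -/
def IsTransverse (b φ : ℤ → ℝ → ℝ) (μc : ℝ) : Prop :=
  ∀ k : ℤ, 0 < deriv (φ k) μc -
    max 0 (max (pieceSlope b φ (k - 1) μc * deriv (b k) μc)
      (pieceSlope b φ k μc * deriv (b k) μc))

/-- The points of the line some iterate `F^j`, `0 ≤ j < q`, of which is a break point. If
`F^q = id + p`, this is the union of the orbits (on the circle) of the break points. -/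
def breakOrbits (F : CircleDeg1Lift) (b : ℤ → ℝ) (q : ℕ) : Set ℝ :=
  {x | ∃ j : ℕ, j < q ∧ ∃ k : ℤ, (F ^ j) x = b k}

/-- `ℓ_0 < ℓ_1 < ⋯ < ℓ_N = ℓ_0 + 1` are the points of `L` in one period. -/
structure IsPeriodEnumeration (L : Set ℝ) (N : ℕ) (ℓ : ℕ → ℝ) : Prop where
  strictMonoOn : StrictMonoOn ℓ (Set.Iic N)
  last_eq : ℓ N = ℓ 0 + 1
  image_eq : ℓ '' Set.Iic N = L ∩ Set.Icc (ℓ 0) (ℓ N)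

/-- First order expansion of `G_μ` between two consecutive points `l < l'`. With
`M(μ) = l + γ|μ - μc|` and `m(μ) = l' - γ|μ - μc|`, the map `G_μ` is affine on `[M(μ), m(μ)]`,
with slope `S(μ) = 1 + B (μ - μc) + O((μ - μc)²)`, and
`G_μ(M(μ)) - M(μ) = A (μ - μc) + O((μ - μc)²)`. These conditions determine `A` and `B`. -/
def HasLaminarCoeffs (G : ℝ → ℝ → ℝ) (μc l l' A B : ℝ) : Prop :=
  ∃ γ : ℝ, 0 < γ ∧ ∃ S : ℝ → ℝ,
    (∀ᶠ μ in 𝓝 μc, ∀ x ∈ Set.Icc (l + γ * |μ - μc|) (l' - γ * |μ - μc|),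
      G μ x = G μ (l + γ * |μ - μc|) + S μ * (x - (l + γ * |μ - μc|))) ∧
    (fun μ => G μ (l + γ * |μ - μc|) - (l + γ * |μ - μc|) - A * (μ - μc))
      =O[𝓝 μc] (fun μ => (μ - μc) ^ 2) ∧
    (fun μ => S μ - 1 - B * (μ - μc)) =O[𝓝 μc] (fun μ => (μ - μc) ^ 2)

/-- The coefficient `κ` of a component of length `d`. -/
def kappa (d A B : ℝ) : ℝ :=
  if B = 0 then d / A else 1 / B * Real.log (1 + d * B / A)

end

/-! Conjugacy to the rotation by `p/q` forces `F_{μc}^q = id + p`, so with `ε = μ - μc` the map `G_μ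
= F_μ^q - p` is close to the identity. Between consecutive points of the break orbits `L`, `G_μ` is
a composition of affine pieces depending smoothly on `μ`, whence `G_μ(x) = x + ε v(x) + O(ε²)` with
`v(x) = A_i + B_i (x - ℓ_i)` (`IsItinerary.eventually_abs_step_sub_le`). Within distance `O(ε)` of
`L` the itinerary may change, and there only `ε/K ≤ G_μ(x) - x ≤ Kε` (for `ε > 0`) is available
(`eventually_pow_gap`). Transversality makes every point move upwards at positive speed, which gives
both this bound and `v > 0`.

So `G_μ` is nearly the time-`ε` map of the flow of `v`, whose rotation number is `ε / ∫₀¹ 1/v`, and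
the integral of `1/v` over the `i`-th cell is `κ_i` (`integral_velocity`).

To control the error, time is measured by a periodic density `w`: if each application of `g`
advances this clock by at most (at least) `η`, then `τ(g) ∫₀¹ w` is at most (at least) `η`. Away
from `L` the density `1/v` advances by `ε + O(ε²)`. In windows of radius `O(ε)` around `L` it is
increased by `K` for one bound and replaced by `0` for the other, so that the step inequality holds
there trivially (`clock_step`). The windows have measure `O(ε)` in a period and `τ(g) = O(ε)`, so
the correction costs only `O(ε²)`: `τ(g) ∫₀¹ 1/v = ε + O(ε²)` (`abs_translationNumber_mul_sub_le`).
Finally `τ(G_μ) = q ρ(F_μ) - p`. -/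

/-! ### Clocks, and the rotation number of a near-identity map -/

section Clock

open MeasureTheory

/-- The primitive of a periodic function is a linear function up to a bounded error. -/
lemma exists_abs_primitive_sub_le {w : ℝ → ℝ} (hw : Function.Periodic w 1)
    (hint : ∀ a b, IntervalIntegrable w volume a b) :
    ∃ C, ∀ y, |(∫ t in (0 : ℝ)..y, w t) - y * ∫ t in (0 : ℝ)..1, w t| ≤ C := by
  set W := ∫ t in (0 : ℝ)..1, w t
  set r : ℝ → ℝ := fun y => (∫ t in (0 : ℝ)..y, w t) - y * W with hr
  have hper : Function.Periodic r 1 := by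
    intro y
    have h1 : (∫ t in y..(y + 1), w t) = W := by
      have := hw.intervalIntegral_add_eq y 0
      simpa using this
    have h2 := intervalIntegral.integral_add_adjacent_intervals (hint 0 y) (hint y (y + 1))
    simp only [hr]
    rw [← h2, h1]
    ring
  have hcont : Continuous r :=
    (intervalIntegral.continuous_primitive hint 0).sub (continuous_id.mul continuous_const)
  obtain ⟨C, hC⟩ := isCompact_Icc.exists_bound_of_continuousOn (s := Set.Icc (0 : ℝ) 1)
    hcont.continuousOn
  refine ⟨C, fun y => ?_⟩
  obtain ⟨z, hz, hyz⟩ := hper.exists_mem_Ico₀ one_pos y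
  have := hC z (Set.Ico_subset_Icc_self hz)
  rw [← hyz] at this
  simpa [hr] using this

/-- If the clock with density `w` advances by at most `η` at each application of `g`, then
`τ(g) ∫₀¹ w ≤ η`. -/
lemma translationNumber_mul_integral_le {w : ℝ → ℝ} (hw : Function.Periodic w 1)
    (hint : ∀ a b, IntervalIntegrable w volume a b) (g : CircleDeg1Lift) {η : ℝ}
    (h : ∀ x, ∫ t in x..(g x), w t ≤ η) :
    g.translationNumber * (∫ t in (0 : ℝ)..1, w t) ≤ η := by
  obtain ⟨C, hC⟩ := exists_abs_primitive_sub_le hw hint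
  set W := ∫ t in (0 : ℝ)..1, w t
  have hstep : ∀ m : ℕ, ∫ t in (0 : ℝ)..((g ^ m) 0), w t ≤ m * η := by
    intro m
    induction m with
    | zero => simp
    | succ m ih =>
      rw [pow_succ', CircleDeg1Lift.mul_apply,
        ← intervalIntegral.integral_add_adjacent_intervals (hint 0 ((g ^ m) 0)) (hint _ _)]
      have := h ((g ^ m) 0)
      push_cast
      linarith
  have hlim : Tendsto (fun m : ℕ => (g ^ m) 0 / m * W) atTop (𝓝 (g.translationNumber * W)) :=
    g.tendsto_translation_number₀.mul_const W
  have hlim2 : Tendsto (fun m : ℕ => η + C / m) atTop (𝓝 (η + 0)) :=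
    tendsto_const_nhds.add (tendsto_const_div_atTop_nhds_zero_nat C)
  rw [add_zero] at hlim2
  refine le_of_tendsto_of_tendsto hlim hlim2 ?_
  filter_upwards [eventually_gt_atTop 0] with m hm
  have hm' : (0 : ℝ) < m := by exact_mod_cast hm
  have h1 := (abs_le.1 (hC ((g ^ m) 0))).1
  have h2 := hstep m
  have e1 : (g ^ m) 0 / (m : ℝ) * W = ((g ^ m) 0 * W) / m := by ring
  have e2 : η + C / m = (m * η + C) / m := by field_simp
  rw [e1, e2]
  gcongr
  linarith

lemma le_translationNumber_mul_integral {w : ℝ → ℝ} (hw : Function.Periodic w 1)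
    (hint : ∀ a b, IntervalIntegrable w volume a b) (g : CircleDeg1Lift) {η : ℝ}
    (h : ∀ x, η ≤ ∫ t in x..(g x), w t) :
    η ≤ g.translationNumber * (∫ t in (0 : ℝ)..1, w t) := by
  have := translationNumber_mul_integral_le (w := fun t => -w t) (fun x => by simp [hw x])
    (fun a b => (hint a b).neg) g (η := -η) (fun x => by simpa using h x)
  simp only [intervalIntegral.integral_neg] at this
  linarith

/-- The closed `r`-neighbourhood of `L` as a union of intervals. -/
def windows (L : Set ℝ) (r : ℝ) : Set ℝ := {x | ∃ l ∈ L, |x - l| ≤ r}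

lemma measurableSet_windows {L : Set ℝ} (hL : L.Countable) (r : ℝ) :
    MeasurableSet (windows L r) := by
  have : windows L r = ⋃ l ∈ L, Metric.closedBall l r := by
    ext x; simp [windows, Real.dist_eq]
  rw [this]
  exact MeasurableSet.biUnion hL fun l _ => measurableSet_closedBall

/-- Since `r ≤ 1`, only centres in `[-1, 2]` have windows reaching `(0, 1]`; each contributes at
most `2r`. -/
lemma integral_windows_le {L : Set ℝ} (hL : L.Countable) (S : Finset ℝ)
    (hS : L ∩ Set.Icc (-1) 2 ⊆ S) {r : ℝ} (hr0 : 0 ≤ r) (hr : r ≤ 1) :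
    ∫ t in (0 : ℝ)..1, (windows L r).indicator 1 t ≤ S.card * (2 * r) := by
  rw [intervalIntegral.integral_of_le zero_le_one, integral_indicator_one
    (measurableSet_windows hL r), measureReal_restrict_apply (measurableSet_windows hL r)]
  have hsub : windows L r ∩ Set.Ioc 0 1 ⊆ ⋃ l ∈ S, Metric.closedBall l r := by
    rintro x ⟨⟨l, hl, hxl⟩, hx0, hx1⟩
    have := abs_le.1 hxl
    refine Set.mem_biUnion (hS ⟨hl, by constructor <;> linarith⟩) ?_
    simpa [Real.dist_eq] using hxl
  calc volume.real (windows L r ∩ Set.Ioc 0 1)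
      ≤ volume.real (⋃ l ∈ S, Metric.closedBall l r) := by
        refine measureReal_mono hsub ?_
        refine ((measure_biUnion_finset_le S _).trans_lt ?_).ne
        exact ENNReal.sum_lt_top.2 fun l _ => measure_closedBall_lt_top
    _ ≤ ∑ l ∈ S, volume.real (Metric.closedBall l r) := measureReal_biUnion_finset_le _ _
    _ = S.card * (2 * r) := by
        simp [Measure.real, Real.volume_closedBall, ENNReal.toReal_ofReal, hr0]

lemma windows_periodic {L : Set ℝ} (hL : ∀ x, x + 1 ∈ L ↔ x ∈ L) (r x : ℝ) :
    x + 1 ∈ windows L r ↔ x ∈ windows L r := by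
  constructor
  · rintro ⟨l, hl, h⟩
    refine ⟨l - 1, (hL _).1 (by simpa using hl), ?_⟩
    convert h using 2; ring
  · rintro ⟨l, hl, h⟩
    refine ⟨l + 1, (hL _).2 hl, ?_⟩
    convert h using 2; ring

/-- A velocity field on the line, discontinuous at most at the points of `L`, with
constants controlled by `K`. -/
structure IsVelocity (L : Set ℝ) (v : ℝ → ℝ) (K : ℝ) : Prop where
  periodic : Function.Periodic v 1
  lower : ∀ x, 1 / K ≤ v x
  upper : ∀ x, v x ≤ K
  lipschitz : ∀ x y, Disjoint (Set.uIcc x y) L → |v x - v y| ≤ K * |x - y|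
  integrable : ∀ a b, IntervalIntegrable (fun x => (v x)⁻¹) volume a b

variable {L : Set ℝ} {v : ℝ → ℝ} {K : ℝ}

lemma IsVelocity.inv_le (h : IsVelocity L v K) (hK : 0 < K) (x : ℝ) : (v x)⁻¹ ≤ K := by
  have := inv_anti₀ (by positivity) (h.lower x)
  simpa using this

lemma IsVelocity.pos (h : IsVelocity L v K) (hK : 0 < K) (x : ℝ) : 0 < v x :=
  lt_of_lt_of_le (by positivity) (h.lower x)

/-- A step of length `δ v + O(δ²)` takes time `δ + O(δ²)`. -/
lemma IsVelocity.abs_integral_inv_sub_le (h : IsVelocity L v K) (hK : 0 < K) {a b z δ : ℝ}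
    (hab : a ≤ b) (hz : z ∈ Set.Icc a b) (hδ : 0 ≤ δ) (hdisj : Disjoint (Set.Icc a b) L)
    (hlen : b - a ≤ K * δ) (hstep : |b - a - δ * v z| ≤ K * δ ^ 2) :
    |(∫ t in a..b, (v t)⁻¹) - δ| ≤ (K ^ 5 + K ^ 2) * δ ^ 2 := by
  have hvz := h.pos hK z
  have h1 : |∫ t in a..b, ((v t)⁻¹ - (v z)⁻¹)| ≤ (K ^ 4 * δ) * |b - a| := by
    rw [← Real.norm_eq_abs]
    refine intervalIntegral.norm_integral_le_of_norm_le_const fun t ht => ?_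
    rw [Set.uIoc_of_le hab] at ht
    have hvt := h.pos hK t
    have e : (v t)⁻¹ - (v z)⁻¹ = (v t)⁻¹ * (v z)⁻¹ * (v z - v t) := by field_simp
    have hzt : |z - t| ≤ K * δ := by
      rw [abs_le]; constructor <;> linarith [hz.1, hz.2, ht.1, ht.2]
    have hl : |v z - v t| ≤ K * |z - t| :=
      h.lipschitz z t (hdisj.mono_left (Set.uIcc_subset_Icc hz ⟨ht.1.le, ht.2⟩))
    rw [Real.norm_eq_abs, e, abs_mul, abs_of_pos (by positivity)]
    calc (v t)⁻¹ * (v z)⁻¹ * |v z - v t| ≤ K * K * (K * (K * δ)) := by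
          have := h.inv_le hK t
          have := h.inv_le hK z
          have : |v z - v t| ≤ K * (K * δ) := hl.trans (by gcongr)
          gcongr
      _ = K ^ 4 * δ := by ring
  have h2 : ∫ t in a..b, ((v t)⁻¹ - (v z)⁻¹) = (∫ t in a..b, (v t)⁻¹) - (b - a) * (v z)⁻¹ := by
    rw [intervalIntegral.integral_sub (h.integrable a b) (by simp)]
    simp
  have h3 : |(b - a) * (v z)⁻¹ - δ| ≤ K ^ 2 * δ ^ 2 := by
    have e : (b - a) * (v z)⁻¹ - δ = (v z)⁻¹ * (b - a - δ * v z) := by field_simp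
    rw [e, abs_mul, abs_of_pos (by positivity)]
    calc (v z)⁻¹ * |b - a - δ * v z| ≤ K * (K * δ ^ 2) := by
          have := h.inv_le hK z
          gcongr
      _ = _ := by ring
  rw [h2, abs_of_nonneg (sub_nonneg.2 hab)] at h1
  have h4 : K ^ 4 * δ * (b - a) ≤ K ^ 5 * δ ^ 2 := by
    calc K ^ 4 * δ * (b - a) ≤ K ^ 4 * δ * (K * δ) := by gcongr
      _ = _ := by ring
  calc |(∫ t in a..b, (v t)⁻¹) - δ|
      = |((∫ t in a..b, (v t)⁻¹) - (b - a) * (v z)⁻¹) + ((b - a) * (v z)⁻¹ - δ)| := by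
        congr 1; ring
    _ ≤ _ := (abs_add_le _ _).trans (by linarith)

/-- The density of a clock which runs fast in the windows. -/
noncomputable def fastClock (L : Set ℝ) (v : ℝ → ℝ) (K r : ℝ) (x : ℝ) : ℝ :=
  (v x)⁻¹ + K * (windows L r).indicator 1 x

/-- The density of a clock which stops in the windows. -/
noncomputable def slowClock (L : Set ℝ) (v : ℝ → ℝ) (r : ℝ) : ℝ → ℝ :=
  (windows L r)ᶜ.indicator fun x => (v x)⁻¹

lemma intervalIntegrable_indicator_windows (hL : L.Countable) (r a b : ℝ) :
    IntervalIntegrable ((windows L r).indicator (1 : ℝ → ℝ)) volume a b := by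
  have h : IntervalIntegrable (1 : ℝ → ℝ) volume a b := intervalIntegrable_const (c := (1 : ℝ))
  exact ⟨h.1.indicator (measurableSet_windows hL r), h.2.indicator (measurableSet_windows hL r)⟩

lemma IsVelocity.intervalIntegrable_fastClock (h : IsVelocity L v K) (hL : L.Countable)
    (r a b : ℝ) : IntervalIntegrable (fastClock L v K r) volume a b :=
  (h.integrable a b).add ((intervalIntegrable_indicator_windows hL r a b).const_mul K)

lemma IsVelocity.intervalIntegrable_slowClock (h : IsVelocity L v K) (hL : L.Countable)
    (r a b : ℝ) : IntervalIntegrable (slowClock L v r) volume a b :=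
  ⟨(h.integrable a b).1.indicator (measurableSet_windows hL r).compl,
    (h.integrable a b).2.indicator (measurableSet_windows hL r).compl⟩

lemma IsVelocity.periodic_fastClock (h : IsVelocity L v K) (hL : ∀ x, x + 1 ∈ L ↔ x ∈ L) (r : ℝ) :
    Function.Periodic (fastClock L v K r) 1 := by
  classical
  intro x
  simp only [fastClock, h.periodic x, Set.indicator_apply, windows_periodic hL, Pi.one_apply]

lemma IsVelocity.periodic_slowClock (h : IsVelocity L v K) (hL : ∀ x, x + 1 ∈ L ↔ x ∈ L) (r : ℝ) :
    Function.Periodic (slowClock L v r) 1 := by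
  classical
  intro x
  simp only [slowClock, h.periodic x, Set.indicator_apply, Set.mem_compl_iff,
    windows_periodic hL]

/-- In one step of length comparable to `δ`, the fast clock advances by at least `δ - O(δ²)` and
the slow clock by at most `δ + O(δ²)`. -/
lemma IsVelocity.clock_step (h : IsVelocity L v K) (hK : 0 < K) (hL : L.Countable)
    {a b z δ : ℝ} (hz : z ∈ Set.Icc a b) (hδ : 0 ≤ δ)
    (hlen' : δ ≤ K * (b - a)) (hlen : b - a ≤ K * δ)
    (hstep : (∀ l ∈ L, K * δ ≤ |z - l|) → |b - a - δ * v z| ≤ K * δ ^ 2) :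
    δ - (K ^ 5 + K ^ 2) * δ ^ 2 ≤ ∫ t in a..b, fastClock L v K (2 * K * δ) t ∧
      ∫ t in a..b, slowClock L v (2 * K * δ) t ≤ δ + (K ^ 5 + K ^ 2) * δ ^ 2 := by
  classical
  have hab : a ≤ b := hz.1.trans hz.2
  have hC : 0 ≤ (K ^ 5 + K ^ 2) * δ ^ 2 := by positivity
  have hfast := h.intervalIntegrable_fastClock hL (2 * K * δ) a b
  have hslow := h.intervalIntegrable_slowClock hL (2 * K * δ) a b
  have hclose : ∀ t ∈ Set.Icc a b, |t - z| ≤ K * δ := fun t ht => by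
    rw [abs_le]; constructor <;> linarith [hz.1, hz.2, ht.1, ht.2]
  -- If `z` is within `Kδ` of `L`, all of `[a, b]` lies in the window of radius `2Kδ`: there the
  -- fast density is at least `K` and `K (b - a) ≥ δ`, while the slow density vanishes. Otherwise
  -- `[a, b]` misses `L` and the expansion of the step applies.
  by_cases hbad : ∃ l ∈ L, |z - l| ≤ K * δ
  · obtain ⟨l, hl, hzl⟩ := hbad
    have hE : ∀ t ∈ Set.Icc a b, t ∈ windows L (2 * K * δ) := fun t ht => by
      refine ⟨l, hl, ?_⟩
      calc |t - l| = |(t - z) + (z - l)| := by congr 1; ring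
        _ ≤ _ := (abs_add_le _ _).trans (by linarith [hclose t ht])
    constructor
    · have : ∫ _t in a..b, K ≤ ∫ t in a..b, fastClock L v K (2 * K * δ) t := by
        refine intervalIntegral.integral_mono_on hab (by simp) hfast fun t ht => ?_
        have := (h.pos hK t)
        simp only [fastClock, Set.indicator_of_mem (hE t ht), Pi.one_apply, mul_one]
        have := inv_pos.2 this
        linarith
      simp only [intervalIntegral.integral_const, smul_eq_mul] at this
      linarith
    · have : ∫ t in a..b, slowClock L v (2 * K * δ) t = ∫ _t in a..b, (0 : ℝ) := by
        refine intervalIntegral.integral_congr fun t ht => ?_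
        rw [Set.uIcc_of_le hab] at ht
        simp [slowClock, hE t ht]
      rw [this]
      simp only [intervalIntegral.integral_zero]
      linarith
  · push Not at hbad
    have hdisj : Disjoint (Set.Icc a b) L := by
      rw [Set.disjoint_left]
      intro t ht htL
      have h1 := hbad t htL
      have h2 := hclose t ht
      rw [abs_sub_comm] at h2
      linarith
    have key := abs_le.1 (h.abs_integral_inv_sub_le hK hab hz hδ hdisj hlen
      (hstep fun l hl => (hbad l hl).le))
    constructor
    · have : ∫ t in a..b, (v t)⁻¹ ≤ ∫ t in a..b, fastClock L v K (2 * K * δ) t := by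
        refine intervalIntegral.integral_mono_on hab (h.integrable a b) hfast fun t _ => ?_
        have : 0 ≤ (windows L (2 * K * δ)).indicator (1 : ℝ → ℝ) t :=
          Set.indicator_nonneg (fun _ _ => zero_le_one) t
        have := mul_nonneg hK.le this
        simp only [fastClock]
        linarith
      linarith
    · have : ∫ t in a..b, slowClock L v (2 * K * δ) t ≤ ∫ t in a..b, (v t)⁻¹ := by
        refine intervalIntegral.integral_mono_on hab hslow (h.integrable a b) fun t _ => ?_
        exact Set.indicator_le_self' (fun _ _ => (inv_pos.2 (h.pos hK t)).le) t
      linarith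

lemma IsVelocity.integral_fastClock_le (h : IsVelocity L v K) (hK : 0 < K) (hL : L.Countable)
    (S : Finset ℝ) (hS : L ∩ Set.Icc (-1) 2 ⊆ S) {r : ℝ} (hr0 : 0 ≤ r) (hr : r ≤ 1) :
    ∫ t in (0 : ℝ)..1, fastClock L v K r t ≤
      (∫ t in (0 : ℝ)..1, (v t)⁻¹) + K * (S.card * (2 * r)) := by
  have h1 := integral_windows_le hL S hS hr0 hr
  unfold fastClock
  rw [intervalIntegral.integral_add (h.integrable 0 1)
    ((intervalIntegrable_indicator_windows hL r 0 1).const_mul K),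
    intervalIntegral.integral_const_mul]
  gcongr

lemma IsVelocity.le_integral_slowClock (h : IsVelocity L v K) (hK : 0 < K) (hL : L.Countable)
    (S : Finset ℝ) (hS : L ∩ Set.Icc (-1) 2 ⊆ S) {r : ℝ} (hr0 : 0 ≤ r) (hr : r ≤ 1) :
    (∫ t in (0 : ℝ)..1, (v t)⁻¹) - K * (S.card * (2 * r)) ≤
      ∫ t in (0 : ℝ)..1, slowClock L v r t := by
  classical
  have h1 := integral_windows_le hL S hS hr0 hr
  have hi := (intervalIntegrable_indicator_windows hL r 0 1).const_mul K
  -- Pointwise bound: inside the windows the left side is nonpositive because `1/v ≤ K`.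
  have h2 : (∫ t in (0 : ℝ)..1, ((v t)⁻¹ - K * (windows L r).indicator 1 t)) ≤
      ∫ t in (0 : ℝ)..1, slowClock L v r t := by
    refine intervalIntegral.integral_mono_on zero_le_one ((h.integrable 0 1).sub hi)
      (h.intervalIntegrable_slowClock hL r 0 1) fun t _ => ?_
    by_cases ht : t ∈ windows L r
    · have := h.inv_le hK t
      simp [slowClock, ht, this]
    · simp [slowClock, ht]
  rw [intervalIntegral.integral_sub (h.integrable 0 1) hi,
    intervalIntegral.integral_const_mul] at h2
  have := mul_le_mul_of_nonneg_left h1 hK.le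
  linarith

/-- The rotation number of a map close to the time-`ε` map of the flow of `v`. -/
theorem IsVelocity.abs_translationNumber_mul_sub_le (h : IsVelocity L v K) (hK : 0 < K)
    (hLc : L.Countable) (hLp : ∀ x, x + 1 ∈ L ↔ x ∈ L)
    (S : Finset ℝ) (hS : L ∩ Set.Icc (-1) 2 ⊆ S) {ε : ℝ} (hε : ε ≠ 0) (hsmall : 2 * K * |ε| ≤ 1)
    (g : CircleDeg1Lift) (hlow : ∀ x, 1 / K ≤ (g x - x) / ε) (hup : ∀ x, (g x - x) / ε ≤ K)
    (hstep : ∀ x, (∀ l ∈ L, K * |ε| ≤ |x - l|) → |g x - x - ε * v x| ≤ K * ε ^ 2) :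
    |g.translationNumber * (∫ t in (0 : ℝ)..1, (v t)⁻¹) - ε| ≤
      (K ^ 5 + K ^ 2 + 4 * S.card * K ^ 3) * ε ^ 2 := by
  set W := ∫ t in (0 : ℝ)..1, (v t)⁻¹
  set τ := g.translationNumber
  set r := 2 * K * |ε| with hr
  have hr0 : 0 ≤ r := by positivity
  have hIf := h.integral_fastClock_le hK hLc S hS hr0 hsmall
  have hIs := h.le_integral_slowClock hK hLc S hS hr0 hsmall
  have hpf := h.periodic_fastClock hLp r
  have hps := h.periodic_slowClock hLp r
  have hif := h.intervalIntegrable_fastClock hLc r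
  have his := h.intervalIntegrable_slowClock hLc r
  rcases lt_or_gt_of_ne hε with hneg | hpos
  · have habs : |ε| = -ε := abs_of_neg hneg
    have hl1 : ∀ x, -ε ≤ K * (x - g x) := fun x => by
      have := (le_div_iff_of_neg hneg).1 (hlow x)
      rw [one_div, inv_mul_eq_div, le_div_iff₀ hK] at this
      linarith
    have hl2 : ∀ x, x - g x ≤ K * -ε := fun x => by
      have := (div_le_iff_of_neg hneg).1 (hup x)
      linarith
    -- For `ε < 0` the step runs backwards over `[g x, x]`, so the base point `z = x` is now the
    -- right end.
    have hs : ∀ x, _ := fun x => h.clock_step hK hLc (a := g x) (b := x) (z := x) (δ := -ε)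
      ⟨by nlinarith [hl1 x], le_rfl⟩ (by linarith) (hl1 x) (hl2 x) (fun hx => by
        have := hstep x (by rwa [habs])
        rw [← abs_neg] at this
        convert this using 2 <;> ring)
    rw [habs] at hr
    rw [← hr] at hs
    have h1 := translationNumber_mul_integral_le hpf hif g
      (η := -(-ε - (K ^ 5 + K ^ 2) * (-ε) ^ 2)) (fun x => by
        rw [intervalIntegral.integral_symm]
        linarith [(hs x).1])
    have h2 := le_translationNumber_mul_integral hps his g
      (η := -(-ε + (K ^ 5 + K ^ 2) * (-ε) ^ 2)) (fun x => by
        rw [intervalIntegral.integral_symm]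
        linarith [(hs x).2])
    -- The crude bound `|τ| ≤ K|ε|` turns the `O(ε)` error of the period integrals into `O(ε²)`.
    have t1 : K * ε ≤ τ := g.le_translationNumber_of_add_le fun x => by linarith [hl2 x]
    have t2 : τ ≤ 0 := g.translationNumber_le_of_le_add fun x => by nlinarith [hl1 x]
    have m1 := mul_le_mul_of_nonpos_left hIf t2
    have m2 := mul_le_mul_of_nonpos_left hIs t2
    have m3 : K * ε * (K * (S.card * (2 * r))) ≤ τ * (K * (S.card * (2 * r))) := by gcongr
    generalize (∫ t in (0 : ℝ)..1, fastClock L v K r t) = If at *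
    generalize (∫ t in (0 : ℝ)..1, slowClock L v r t) = Is at *
    rw [hr] at m1 m2 m3
    rw [abs_le]
    constructor <;> linarith
  · have habs : |ε| = ε := abs_of_pos hpos
    have hl1 : ∀ x, ε ≤ K * (g x - x) := fun x => by
      have := (le_div_iff₀ hpos).1 (hlow x)
      rw [one_div, inv_mul_eq_div, div_le_iff₀ hK] at this
      linarith
    have hl2 : ∀ x, g x - x ≤ K * ε := fun x => (div_le_iff₀ hpos).1 (hup x)
    have hs : ∀ x, _ := fun x => h.clock_step hK hLc (a := x) (b := g x) (z := x) (δ := ε)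
      ⟨le_rfl, by nlinarith [hl1 x]⟩ hpos.le (hl1 x) (hl2 x) (fun hx => hstep x (by rwa [habs]))
    rw [habs] at hr
    rw [← hr] at hs
    have h1 := le_translationNumber_mul_integral hpf hif g fun x => (hs x).1
    have h2 := translationNumber_mul_integral_le hps his g fun x => (hs x).2
    have t1 : τ ≤ K * ε := g.translationNumber_le_of_le_add fun x => by linarith [hl2 x]
    have t2 : 0 ≤ τ := g.le_translationNumber_of_add_le fun x => by nlinarith [hl1 x]
    have m1 := mul_le_mul_of_nonneg_left hIf t2
    have m2 := mul_le_mul_of_nonneg_left hIs t2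
    have m3 : τ * (K * (S.card * (2 * r))) ≤ K * ε * (K * (S.card * (2 * r))) := by gcongr
    generalize (∫ t in (0 : ℝ)..1, fastClock L v K r t) = If at *
    generalize (∫ t in (0 : ℝ)..1, slowClock L v r t) = Is at *
    rw [hr] at m1 m2 m3
    rw [abs_le]
    constructor <;> linarith

end Clock

/-! ### Taylor remainders and difference quotients -/

section Calculus

/-- First order Taylor expansion with quadratic remainder. -/
lemma ContDiffAt.isBigO_sub_sub_deriv_mul {f : ℝ → ℝ} {c : ℝ} (hf : ContDiffAt ℝ 2 f c) :
    (fun x => f x - f c - deriv f c * (x - c)) =O[𝓝 c] (fun x => (x - c) ^ 2) := by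
  have hd : ContDiffAt ℝ 1 (deriv f) c := hf.derivWithin (by norm_num)
  obtain ⟨C, hC⟩ := (hd.differentiableAt one_ne_zero).isBigO_sub.bound
  have hdf : ∀ᶠ x in 𝓝 c, DifferentiableAt ℝ f x :=
    (hf.eventually (by simp)).mono fun x hx => hx.differentiableAt two_ne_zero
  obtain ⟨δ, hδ, hball⟩ := Metric.eventually_nhds_iff_ball.1 (hC.and hdf)
  refine IsBigO.of_bound C ?_
  filter_upwards [Metric.ball_mem_nhds c hδ] with x hx
  have hsub : ∀ y ∈ Metric.closedBall c |x - c|, y ∈ Metric.ball c δ := fun y hy =>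
    lt_of_le_of_lt hy (by simpa [Real.dist_eq] using hx)
  have hder : ∀ y ∈ Metric.closedBall c |x - c|,
      HasDerivAt (fun y => f y - deriv f c * y) (deriv f y - deriv f c) y := fun y hy => by
    have := ((hball y (hsub y hy)).2.hasDerivAt).sub ((hasDerivAt_id y).const_mul (deriv f c))
    rwa [mul_one] at this
  have hC0 : 0 ≤ C * |x - c| := by
    have := (hball x hx).1
    exact (norm_nonneg _).trans this
  -- Mean value inequality for `f y - f'(c) y`, whose derivative is at most `C |x - c|` on this
  -- ball.
  have := (convex_closedBall c |x - c|).norm_image_sub_le_of_norm_deriv_le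
    (f := fun y => f y - deriv f c * y) (C := C * |x - c|) (x := c) (y := x)
    (fun y hy => (hder y hy).differentiableAt)
    (fun y hy => by
      rw [(hder y hy).deriv]
      refine (hball y (hsub y hy)).1.trans ?_
      have h1 : ‖y - c‖ ≤ |x - c| := by simpa [Real.dist_eq] using hy
      rcases le_or_gt 0 C with h0 | h0
      · gcongr
      · have : |x - c| = 0 := by
          by_contra hne
          have : 0 < |x - c| := lt_of_le_of_ne (abs_nonneg _) (Ne.symm hne)
          nlinarith
        have h2 : ‖y - c‖ = 0 := le_antisymm (by linarith) (norm_nonneg _)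
        rw [this, h2])
    (by simp) (by simp [Real.dist_eq])
  have e : f x - f c - deriv f c * (x - c) =
      (f x - deriv f c * x) - (f c - deriv f c * c) := by ring
  rw [e]
  refine this.trans (le_of_eq ?_)
  rw [norm_pow, Real.norm_eq_abs]
  ring

/-- A function vanishing at `c` with positive derivative there has bounded and positive difference
quotients. -/
lemma HasDerivAt.eventually_div_mem_Icc {f : ℝ → ℝ} {c f' : ℝ} (hf : HasDerivAt f f' c)
    (h0 : f c = 0) (hpos : 0 < f') :
    ∀ᶠ K : ℝ in atTop, ∀ᶠ x in 𝓝[≠] c, f x / (x - c) ∈ Set.Icc (1 / K) K := by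
  have hinv : Tendsto (fun K : ℝ => 1 / K) atTop (𝓝 0) := by
    simpa using tendsto_inv_atTop_zero (𝕜 := ℝ)
  filter_upwards [eventually_gt_atTop f', hinv.eventually (gt_mem_nhds hpos)] with K hK1 hK2
  have ht := hasDerivAt_iff_tendsto_slope.1 hf
  filter_upwards [ht.eventually (Icc_mem_nhds hK2 hK1)] with x hx
  rwa [slope_def_field, h0, sub_zero] at hx

/-- If `u ≥ 0` at `c` and `S > 0` at `c`, then `u + S γ |x - c| ≥ 0` near `c` for large `γ`. -/
lemma eventually_add_mul_abs_nonneg {u S : ℝ → ℝ} {c : ℝ} (hu : DifferentiableAt ℝ u c)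
    (hS : ContinuousAt S c) (hu0 : 0 ≤ u c) (hS0 : 0 < S c) :
    ∀ᶠ γ : ℝ in atTop, ∀ᶠ x in 𝓝 c, 0 ≤ u x + S x * (γ * |x - c|) := by
  obtain ⟨C, hC⟩ := hu.isBigO_sub.bound
  filter_upwards [eventually_ge_atTop (2 * C / S c), eventually_ge_atTop 0] with γ hγ hγ0
  have hS' : ∀ᶠ x in 𝓝 c, S c / 2 < S x := hS.eventually (lt_mem_nhds (by linarith))
  -- `u` drops by at most `C |x - c|`; since `S x > S c / 2`, the choice `γ ≥ 2C / S c` compensates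
  -- for it.
  filter_upwards [hC, hS'] with x hx hSx
  simp only [Real.norm_eq_abs] at hx
  have h1 := (abs_le.1 hx).1
  have h2 : C * |x - c| ≤ S x * (γ * |x - c|) := by
    rw [← mul_assoc]
    refine mul_le_mul_of_nonneg_right ?_ (abs_nonneg _)
    rw [div_le_iff₀ hS0] at hγ
    nlinarith
  linarith

end Calculus

/-! ### Piecewise linear families and the speed of points -/

section PiecewiseLinear

/-- The affine function extending the `k`-th piece. -/
noncomputable def affinePiece (b φ : ℤ → ℝ → ℝ) (k : ℤ) (μ x : ℝ) : ℝ :=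
  φ k μ + pieceSlope b φ k μ * (x - b k μ)

variable {n : ℕ} {I : Set ℝ} {b φ : ℤ → ℝ → ℝ} {F : ℝ → CircleDeg1Lift} {μ μc : ℝ}

namespace IsPWLFamily

lemma n_ne_zero (hF : IsPWLFamily n I b φ F) (hμ : μ ∈ I) : n ≠ 0 := by
  rintro rfl
  simpa using hF.break_periodic μ hμ 0

lemma strictMono_break (hF : IsPWLFamily n I b φ F) (hμ : μ ∈ I) : StrictMono fun k => b k μ :=
  strictMono_int_of_lt_succ (hF.break_lt μ hμ)

lemma break_add_mul (hF : IsPWLFamily n I b φ F) (hμ : μ ∈ I) (k m : ℤ) :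
    b (k + m * n) μ = b k μ + m := by
  induction m with
  | zero => simp
  | succ m ih =>
    have := hF.break_periodic μ hμ (k + m * n)
    rw [ih] at this
    rw [show k + ((m : ℤ) + 1) * n = k + m * n + n by ring, this]
    push_cast; ring
  | pred m ih =>
    have := hF.break_periodic μ hμ (k + (-(m : ℤ) - 1) * n)
    rw [show k + (-(m : ℤ) - 1) * n + n = k + -(m : ℤ) * n by ring, ih] at this
    push_cast at this ⊢
    linarith

lemma value_add_mul (hF : IsPWLFamily n I b φ F) (hμ : μ ∈ I) (k m : ℤ) :
    φ (k + m * n) μ = φ k μ + m := by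
  induction m with
  | zero => simp
  | succ m ih =>
    have := hF.value_periodic μ hμ (k + m * n)
    rw [ih] at this
    rw [show k + ((m : ℤ) + 1) * n = k + m * n + n by ring, this]
    push_cast; ring
  | pred m ih =>
    have := hF.value_periodic μ hμ (k + (-(m : ℤ) - 1) * n)
    rw [show k + (-(m : ℤ) - 1) * n + n = k + -(m : ℤ) * n by ring, ih] at this
    push_cast at this ⊢
    linarith

lemma slope_add_mul (hF : IsPWLFamily n I b φ F) (hμ : μ ∈ I) (k m : ℤ) :
    pieceSlope b φ (k + m * n) μ = pieceSlope b φ k μ := by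
  unfold pieceSlope
  rw [show k + m * n + 1 = (k + 1) + m * n by ring, hF.break_add_mul hμ, hF.break_add_mul hμ,
    hF.value_add_mul hμ, hF.value_add_mul hμ]
  ring_nf

lemma exists_mem_Ico (hF : IsPWLFamily n I b φ F) (hμ : μ ∈ I) (x : ℝ) :
    ∃ k, x ∈ Set.Ico (b k μ) (b (k + 1) μ) := by
  have hn : (0 : ℤ) < n := by
    have := hF.n_ne_zero hμ
    positivity
  obtain ⟨M, hM⟩ := exists_int_gt (x - b 0 μ)
  obtain ⟨m, hm⟩ := exists_int_lt (x - b 0 μ)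
  have h1 := hF.break_add_mul hμ 0 M
  have h2 := hF.break_add_mul hμ 0 m
  obtain ⟨k, hk, hmax⟩ := Int.exists_greatest_of_bdd (P := fun k => b k μ ≤ x)
    ⟨0 + M * n, fun z hz => by
      by_contra hlt
      have := hF.strictMono_break hμ (not_le.1 hlt)
      simp only at this
      linarith⟩
    ⟨0 + m * n, by linarith⟩
  refine ⟨k, hk, ?_⟩
  by_contra hlt
  have := hmax (k + 1) (not_lt.1 hlt)
  omega

lemma slope_mul (hF : IsPWLFamily n I b φ F) (hμ : μ ∈ I) (k : ℤ) :
    pieceSlope b φ k μ * (b (k + 1) μ - b k μ) = φ (k + 1) μ - φ k μ :=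
  div_mul_cancel₀ _ (sub_pos.2 (hF.break_lt μ hμ k)).ne'

lemma map_break (hF : IsPWLFamily n I b φ F) (hμ : μ ∈ I) (k : ℤ) : F μ (b k μ) = φ k μ := by
  simpa using hF.eq_affine μ hμ k (b k μ) ⟨le_rfl, hF.break_lt μ hμ k⟩

lemma slope_pos (hF : IsPWLFamily n I b φ F) (hμ : μ ∈ I) (k : ℤ) : 0 < pieceSlope b φ k μ := by
  refine div_pos ?_ (sub_pos.2 (hF.break_lt μ hμ k))
  rw [sub_pos, ← hF.map_break hμ, ← hF.map_break hμ]
  exact hF.strictMono_lift μ hμ (hF.break_lt μ hμ k)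

/-- The `k`-th affine piece, based at its right end. -/
lemma affinePiece_eq_right (hF : IsPWLFamily n I b φ F) (hμ : μ ∈ I) (k : ℤ) (x : ℝ) :
    affinePiece b φ k μ x = φ (k + 1) μ + pieceSlope b φ k μ * (x - b (k + 1) μ) := by
  have := hF.slope_mul hμ k
  unfold affinePiece
  linarith

lemma map_eq_affinePiece (hF : IsPWLFamily n I b φ F) (hμ : μ ∈ I) {k : ℤ} {x : ℝ}
    (hx : x ∈ Set.Icc (b k μ) (b (k + 1) μ)) : F μ x = affinePiece b φ k μ x := by
  rcases hx.2.lt_or_eq with h | h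
  · exact hF.eq_affine μ hμ k x ⟨hx.1, h⟩
  · rw [h, hF.affinePiece_eq_right hμ, hF.map_break hμ]
    simp

lemma exists_slope_le (hF : IsPWLFamily n I b φ F) (hμ : μ ∈ I) :
    ∃ Λ : ℝ, ∀ k, pieceSlope b φ k μ ≤ Λ := by
  have hn : (0 : ℤ) < n := by
    have := hF.n_ne_zero hμ
    positivity
  obtain ⟨Λ, hΛ⟩ := ((Finset.Ico (0 : ℤ) n).image (pieceSlope b φ · μ)).exists_le
  refine ⟨Λ, fun k => ?_⟩
  have := hF.slope_add_mul hμ (k % n) (k / n)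
  rw [Int.emod_add_ediv_mul] at this
  rw [this]
  exact hΛ _ (Finset.mem_image_of_mem _ <| Finset.mem_Ico.2 ⟨Int.emod_nonneg _ hn.ne', Int.emod_lt_of_pos _ hn⟩)

/-- The right derivative exists everywhere and is one of the slopes, so a comparison theorem for
right derivatives gives the global bound without counting pieces. -/
lemma exists_lipschitz (hF : IsPWLFamily n I b φ F) (hμ : μ ∈ I) :
    ∃ Λ : ℝ, 0 ≤ Λ ∧ ∀ x y, x ≤ y → F μ y - F μ x ≤ Λ * (y - x) := by
  obtain ⟨Λ, hΛ⟩ := hF.exists_slope_le hμ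
  refine ⟨Λ, (hF.slope_pos hμ 0).le.trans (hΛ 0), fun x y hxy => ?_⟩
  choose κ hκ using hF.exists_mem_Ico hμ
  have hd : ∀ z ∈ Set.Ico x y,
      HasDerivWithinAt (F μ) (pieceSlope b φ (κ z) μ) (Set.Ici z) z := by
    intro z _
    have h1 : HasDerivWithinAt (affinePiece b φ (κ z) μ) (pieceSlope b φ (κ z) μ)
        (Set.Ici z) z := by
      have := (((hasDerivAt_id z).sub_const (b (κ z) μ)).const_mul
        (pieceSlope b φ (κ z) μ)).const_add (φ (κ z) μ)
      rw [mul_one] at this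
      exact this.hasDerivWithinAt
    refine h1.congr_of_eventuallyEq ?_ (hF.eq_affine μ hμ _ z (hκ z))
    filter_upwards [self_mem_nhdsWithin, mem_nhdsWithin_of_mem_nhds (Iio_mem_nhds (hκ z).2)]
      with w hw1 hw2
    exact hF.eq_affine μ hμ _ w ⟨(hκ z).1.trans hw1, hw2⟩
  have := image_le_of_deriv_right_le_deriv_boundary (f := F μ)
    (hF.continuous_lift μ hμ).continuousOn hd (B := fun z => F μ x + Λ * (z - x))
    (B' := fun _ => Λ) (by simp) (by fun_prop)
    (fun z _ => by
      simpa using ((((hasDerivAt_id z).sub_const x).const_mul Λ).const_add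
        (F μ x)).hasDerivWithinAt)
    (fun z _ => hΛ _) (Set.right_mem_Icc.2 hxy)
  linarith

lemma contDiffAt_break (hF : IsPWLFamily n I b φ F) (hI : IsOpen I) (hμ : μ ∈ I) (k : ℤ) :
    ContDiffAt ℝ 2 (b k) μ :=
  (hF.contDiffOn_break k).contDiffAt (hI.mem_nhds hμ)

lemma contDiffAt_value (hF : IsPWLFamily n I b φ F) (hI : IsOpen I) (hμ : μ ∈ I) (k : ℤ) :
    ContDiffAt ℝ 2 (φ k) μ :=
  (hF.contDiffOn_value k).contDiffAt (hI.mem_nhds hμ)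

lemma contDiffAt_slope (hF : IsPWLFamily n I b φ F) (hI : IsOpen I) (hμ : μ ∈ I) (k : ℤ) :
    ContDiffAt ℝ 2 (pieceSlope b φ k) μ :=
  ((hF.contDiffAt_value hI hμ _).sub (hF.contDiffAt_value hI hμ _)).div
    ((hF.contDiffAt_break hI hμ _).sub (hF.contDiffAt_break hI hμ _))
    (sub_pos.2 (hF.break_lt μ hμ k)).ne'

/-- The speed of the affine function of slope `s_j` through the vertex `k`. -/
lemma hasDerivAt_vertex (hF : IsPWLFamily n I b φ F) (hI : IsOpen I) (hμ : μ ∈ I) (j k : ℤ)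
    {h : ℝ → ℝ} {h' : ℝ} (hh : HasDerivAt h h' μ) :
    HasDerivAt (fun ν => φ k ν + pieceSlope b φ j ν * (h ν - b k ν))
      (deriv (φ k) μ + deriv (pieceSlope b φ j) μ * (h μ - b k μ) +
        pieceSlope b φ j μ * (h' - deriv (b k) μ)) μ := by
  have h1 := ((hF.contDiffAt_value hI hμ k).differentiableAt two_ne_zero).hasDerivAt
  have h2 := ((hF.contDiffAt_break hI hμ k).differentiableAt two_ne_zero).hasDerivAt
  have h3 := ((hF.contDiffAt_slope hI hμ j).differentiableAt two_ne_zero).hasDerivAt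
  convert! h1.add (h3.mul (hh.sub h2)) using 1
  simp only [Pi.sub_apply]
  ring

end IsPWLFamily

lemma IsTransverse.pos_right (h : IsTransverse b φ μc) (k : ℤ) :
    0 < deriv (φ k) μc - pieceSlope b φ k μc * deriv (b k) μc :=
  (h k).trans_le (sub_le_sub_left ((le_max_right _ _).trans (le_max_right _ _)) _)

lemma IsTransverse.pos_left (h : IsTransverse b φ μc) (k : ℤ) :
    0 < deriv (φ k) μc - pieceSlope b φ (k - 1) μc * deriv (b k) μc :=
  (h k).trans_le (sub_le_sub_left ((le_max_left _ _).trans (le_max_right _ _)) _)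

lemma IsTransverse.pos (h : IsTransverse b φ μc) {j k : ℤ} (hj : j = k - 1 ∨ j = k) :
    0 < deriv (φ k) μc - pieceSlope b φ j μc * deriv (b k) μc := by
  rcases hj with rfl | rfl
  exacts [h.pos_left k, h.pos_right _]

namespace IsPWLFamily

/-- The pieces through the vertex `k`. -/
lemma affinePiece_eq_vertex (hF : IsPWLFamily n I b φ F) (hμ : μ ∈ I) {j k : ℤ}
    (hj : j = k - 1 ∨ j = k) (x : ℝ) :
    affinePiece b φ j μ x = φ k μ + pieceSlope b φ j μ * (x - b k μ) := by
  rcases hj with rfl | rfl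
  · simpa using hF.affinePiece_eq_right hμ (k - 1) x
  · rfl

lemma exists_eq_affinePiece_of_mem_Ioo (hF : IsPWLFamily n I b φ F) (hμ : μ ∈ I) {k : ℤ} {x : ℝ}
    (hx : x ∈ Set.Ioo (b (k - 1) μ) (b (k + 1) μ)) :
    ∃ j, (j = k - 1 ∨ j = k) ∧ F μ x = affinePiece b φ j μ x := by
  rcases le_total x (b k μ) with h | h
  · exact ⟨k - 1, Or.inl rfl, hF.map_eq_affinePiece hμ ⟨hx.1.le, by simpa using h⟩⟩
  · exact ⟨k, Or.inr rfl, hF.map_eq_affinePiece hμ ⟨h, hx.2.le⟩⟩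

/-- For `μ` near `μc` the new break point lies on one of the two old pieces meeting at vertex `k`.
Along either piece the gap has derivative `φ_k' - s_j b_k'`, positive by transversality. Which piece
it is may vary with `μ`, so both are bounded. -/
lemma eventually_gap_new_vertex (hF : IsPWLFamily n I b φ F) (hI : IsOpen I) (hμc : μc ∈ I)
    (ht : IsTransverse b φ μc) (k : ℤ) :
    ∀ᶠ K : ℝ in atTop, ∀ᶠ μ in 𝓝[≠] μc,
      (F μ (b k μ) - F μc (b k μ)) / (μ - μc) ∈ Set.Icc (1 / K) K := by
  have hd : ∀ j, HasDerivAt (fun ν => φ k ν - (φ k μc + pieceSlope b φ j μc * (b k ν - b k μc)))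
      (deriv (φ k) μc - pieceSlope b φ j μc * deriv (b k) μc) μc := fun j => by
    have h1 := ((hF.contDiffAt_value hI hμc k).differentiableAt two_ne_zero).hasDerivAt
    have h2 := ((hF.contDiffAt_break hI hμc k).differentiableAt two_ne_zero).hasDerivAt
    exact h1.sub (((h2.sub_const (b k μc)).const_mul (pieceSlope b φ j μc)).const_add (φ k μc))
  have hk := fun j hj => (hd j).eventually_div_mem_Icc (by simp) (ht.pos hj)
  filter_upwards [hk (k - 1) (Or.inl rfl), hk k (Or.inr rfl)] with K hK1 hK2
  have hIoo : ∀ᶠ μ in 𝓝 μc, b k μ ∈ Set.Ioo (b (k - 1) μc) (b (k + 1) μc) :=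
    (hF.contDiffAt_break hI hμc k).continuousAt.eventually
      (Ioo_mem_nhds (hF.strictMono_break hμc (by omega)) (hF.strictMono_break hμc (by omega)))
  filter_upwards [hK1, hK2, nhdsWithin_le_nhds hIoo, nhdsWithin_le_nhds (hI.mem_nhds hμc)]
    with μ h1 h2 h3 hμ
  obtain ⟨j, hj, hFj⟩ := hF.exists_eq_affinePiece_of_mem_Ioo hμc h3
  rw [hFj, hF.affinePiece_eq_vertex hμc hj, hF.map_break hμ]
  rcases hj with rfl | rfl
  exacts [h1, h2]

/-- The same argument with the roles of old and new pieces exchanged; the derivative at `μc` is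
again `φ_k' - s_j b_k'`. -/
lemma eventually_gap_old_vertex (hF : IsPWLFamily n I b φ F) (hI : IsOpen I) (hμc : μc ∈ I)
    (ht : IsTransverse b φ μc) (k : ℤ) :
    ∀ᶠ K : ℝ in atTop, ∀ᶠ μ in 𝓝[≠] μc,
      (F μ (b k μc) - F μc (b k μc)) / (μ - μc) ∈ Set.Icc (1 / K) K := by
  have hk : ∀ j, (j = k - 1 ∨ j = k) → _ := fun j hj =>
    ((hF.hasDerivAt_vertex hI hμc j k (hasDerivAt_const μc (b k μc))).sub_const
      (φ k μc)).eventually_div_mem_Icc (by simp) (by simpa using ht.pos hj)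
  filter_upwards [hk (k - 1) (Or.inl rfl), hk k (Or.inr rfl)] with K hK1 hK2
  have hlt1 : ∀ᶠ μ in 𝓝 μc, b (k - 1) μ < b k μc :=
    (hF.contDiffAt_break hI hμc (k - 1)).continuousAt.eventually
      (gt_mem_nhds (hF.strictMono_break hμc (by omega)))
  have hlt2 : ∀ᶠ μ in 𝓝 μc, b k μc < b (k + 1) μ :=
    (hF.contDiffAt_break hI hμc (k + 1)).continuousAt.eventually
      (lt_mem_nhds (hF.strictMono_break hμc (by omega)))
  filter_upwards [hK1, hK2, nhdsWithin_le_nhds hlt1, nhdsWithin_le_nhds hlt2,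
    nhdsWithin_le_nhds (hI.mem_nhds hμc)] with μ h1 h2 h3 h4 hμ
  obtain ⟨j, hj, hFj⟩ := hF.exists_eq_affinePiece_of_mem_Ioo hμ ⟨h3, h4⟩
  rw [hFj, hF.affinePiece_eq_vertex hμ hj, hF.map_break hμc]
  rcases hj with rfl | rfl
  exacts [h1, h2]

/-- All points move at a speed which is bounded and bounded away from zero. -/
lemma eventually_gap (hF : IsPWLFamily n I b φ F) (hI : IsOpen I) (hμc : μc ∈ I)
    (ht : IsTransverse b φ μc) :
    ∀ᶠ K : ℝ in atTop, ∀ᶠ μ in 𝓝[≠] μc, ∀ x,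
      (F μ x - F μc x) / (μ - μc) ∈ Set.Icc (1 / K) K := by
  have hn : (0 : ℤ) < n := by
    have := hF.n_ne_zero hμc
    positivity
  have hnew := (eventually_all_finset (Finset.Ico (0 : ℤ) n)).2
    fun k _ => hF.eventually_gap_new_vertex hI hμc ht k
  have hold := (eventually_all_finset (Finset.Ico (0 : ℤ) n)).2
    fun k _ => hF.eventually_gap_old_vertex hI hμc ht k
  filter_upwards [hnew, hold] with K hK1 hK2
  filter_upwards [(eventually_all_finset _).2 hK1, (eventually_all_finset _).2 hK2,
    nhdsWithin_le_nhds (hI.mem_nhds hμc), self_mem_nhdsWithin] with μ h1 h2 hμ hne x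
  have hred : ∀ k : ℤ, k = k % n + k / n * n := fun k => (Int.emod_add_ediv_mul k n).symm
  have hmem : ∀ k : ℤ, k % n ∈ Finset.Ico (0 : ℤ) n := fun k =>
    Finset.mem_Ico.2 ⟨Int.emod_nonneg _ hn.ne', Int.emod_lt_of_pos _ hn⟩
  have g1 : ∀ k, (F μ (b k μ) - F μc (b k μ)) / (μ - μc) ∈ Set.Icc (1 / K) K := fun k => by
    have := h1 _ (hmem k)
    rwa [hred k, hF.break_add_mul hμ, CircleDeg1Lift.map_add_int, CircleDeg1Lift.map_add_int,
      add_sub_add_right_eq_sub]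
  have g2 : ∀ k, (F μ (b k μc) - F μc (b k μc)) / (μ - μc) ∈ Set.Icc (1 / K) K := fun k => by
    have := h2 _ (hmem k)
    rwa [hred k, hF.break_add_mul hμc, CircleDeg1Lift.map_add_int, CircleDeg1Lift.map_add_int,
      add_sub_add_right_eq_sub]
  obtain ⟨k, hk⟩ := hF.exists_mem_Ico hμ x
  obtain ⟨j, hj⟩ := hF.exists_mem_Ico hμc x
  -- Take `y ≤ x < z` adjacent in the union of old and new break points. Both maps are affine on
  -- `[y, z]`, so the quotient at `x` is a convex combination of those at `y` and `z`.
  obtain ⟨y, hy, hyk, hyj, hyx⟩ : ∃ y, (F μ y - F μc y) / (μ - μc) ∈ Set.Icc (1 / K) K ∧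
      y ∈ Set.Icc (b k μ) (b (k + 1) μ) ∧ y ∈ Set.Icc (b j μc) (b (j + 1) μc) ∧ y ≤ x := by
    rcases le_total (b k μ) (b j μc) with h | h
    · exact ⟨_, g2 j, ⟨h, hj.1.trans hk.2.le⟩, ⟨le_rfl, (hF.break_lt μc hμc j).le⟩, hj.1⟩
    · exact ⟨_, g1 k, ⟨le_rfl, (hF.break_lt μ hμ k).le⟩, ⟨h, hk.1.trans hj.2.le⟩, hk.1⟩
  obtain ⟨z, hz, hzk, hzj, hzx⟩ : ∃ y, (F μ y - F μc y) / (μ - μc) ∈ Set.Icc (1 / K) K ∧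
      y ∈ Set.Icc (b k μ) (b (k + 1) μ) ∧ y ∈ Set.Icc (b j μc) (b (j + 1) μc) ∧ x < y := by
    rcases le_total (b (k + 1) μ) (b (j + 1) μc) with h | h
    · exact ⟨_, g1 (k + 1), ⟨(hF.break_lt μ hμ k).le, le_rfl⟩, ⟨hj.1.trans hk.2.le, h⟩, hk.2⟩
    · exact ⟨_, g2 (j + 1), ⟨hk.1.trans hj.2.le, h⟩, ⟨(hF.break_lt μc hμc j).le, le_rfl⟩, hj.2⟩
  have hyz : 0 < z - y := by linarith
  rw [hF.map_eq_affinePiece hμ hyk, hF.map_eq_affinePiece hμc hyj] at hy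
  rw [hF.map_eq_affinePiece hμ hzk, hF.map_eq_affinePiece hμc hzj] at hz
  rw [hF.map_eq_affinePiece hμ ⟨hk.1, hk.2.le⟩, hF.map_eq_affinePiece hμc ⟨hj.1, hj.2.le⟩]
  have key : (affinePiece b φ k μ x - affinePiece b φ j μc x) / (μ - μc) =
      ((z - x) / (z - y)) • ((affinePiece b φ k μ y - affinePiece b φ j μc y) / (μ - μc)) +
      ((x - y) / (z - y)) • ((affinePiece b φ k μ z - affinePiece b φ j μc z) / (μ - μc)) := by
    have : μ - μc ≠ 0 := sub_ne_zero.2 hne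
    simp only [affinePiece, smul_eq_mul]
    field_simp
    ring
  rw [key]
  exact convex_Icc _ _ hy hz (div_nonneg (by linarith) hyz.le) (div_nonneg (by linarith) hyz.le)
    (by field_simp; ring)

end IsPWLFamily

end PiecewiseLinear

/-! ### Perturbation of iterates, and the conjugacy hypothesis -/

section Iterates

lemma CircleDeg1Lift.abs_pow_sub_pow_le {f g : CircleDeg1Lift} {Λ d : ℝ} (hΛ : 0 ≤ Λ)
    (hg : ∀ x y, x ≤ y → g y - g x ≤ Λ * (y - x)) (hd : ∀ x, |f x - g x| ≤ d) (j : ℕ) (x : ℝ) :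
    |(f ^ j) x - (g ^ j) x| ≤ (∑ i ∈ Finset.range j, Λ ^ i) * d := by
  have hg' : ∀ x y, |g y - g x| ≤ Λ * |y - x| := by
    intro x y
    rcases le_total x y with h | h
    · rw [abs_of_nonneg (sub_nonneg.2 (g.mono h)), abs_of_nonneg (sub_nonneg.2 h)]
      exact hg x y h
    · rw [abs_sub_comm, abs_sub_comm y, abs_of_nonneg (sub_nonneg.2 (g.mono h)),
        abs_of_nonneg (sub_nonneg.2 h)]
      exact hg y x h
  induction j with
  | zero => simp
  | succ j ih =>
    rw [pow_succ', pow_succ', CircleDeg1Lift.mul_apply, CircleDeg1Lift.mul_apply,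
      Finset.sum_range_succ']
    have h1 := hd ((f ^ j) x)
    have h2 := (hg' ((g ^ j) x) ((f ^ j) x)).trans (mul_le_mul_of_nonneg_left ih hΛ)
    have h3 := abs_sub_le (f ((f ^ j) x)) (g ((f ^ j) x)) (g ((g ^ j) x))
    have e : ∑ i ∈ Finset.range j, Λ ^ (i + 1) = Λ * ∑ i ∈ Finset.range j, Λ ^ i := by
      rw [Finset.mul_sum]
      exact Finset.sum_congr rfl fun i _ => by ring
    rw [e, pow_zero]
    linarith

/-- Monotonicity keeps the earlier iterates ordered, and the last application alone gains `d`. -/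
lemma CircleDeg1Lift.pow_add_le_pow {f g : CircleDeg1Lift} {d : ℝ} (hd : 0 ≤ d)
    (h : ∀ x, g x + d ≤ f x) {j : ℕ} (hj : 0 < j) (x : ℝ) : (g ^ j) x + d ≤ (f ^ j) x := by
  obtain ⟨j, rfl⟩ := Nat.exists_eq_succ_of_ne_zero hj.ne'
  have hgf : g ≤ f := fun x => by linarith [h x]
  rw [Nat.succ_eq_add_one, pow_succ', pow_succ', CircleDeg1Lift.mul_apply,
    CircleDeg1Lift.mul_apply]
  have h1 : g ((g ^ j) x) ≤ g ((f ^ j) x) := g.mono (CircleDeg1Lift.pow_mono hgf j x)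
  linarith [h ((f ^ j) x)]

/-- If a circle homeomorphism is conjugate to the rotation by `p / q`, which is the rotation number
of its lift `f`, then `f ^ q` is the translation by `p`. -/
lemma IsConjugateToRotation.pow_apply_eq {f : CircleDeg1Lift} {p : ℤ} {q : ℕ} (hq : 0 < q)
    (hconj : IsConjugateToRotation (circleMapOfLift f) ((p : ℝ) / q))
    (hrot : f.translationNumber = (p : ℝ) / q) (x : ℝ) : (f ^ q) x = x + p := by
  obtain ⟨h, hh⟩ := hconj
  have hq' : (q : ℝ) ≠ 0 := by exact_mod_cast hq.ne'
  have hsemi : ∀ (j : ℕ) (y : ℝ),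
      h (((f ^ j) y : ℝ) : UnitAddCircle) = h (y : UnitAddCircle) +
        ((j * ((p : ℝ) / q) : ℝ) : UnitAddCircle) := by
    intro j y
    induction j with
    | zero => simp
    | succ j ih =>
      have h1 : ((f ((f ^ j) y) : ℝ) : UnitAddCircle) =
          circleMapOfLift f (((f ^ j) y : ℝ) : UnitAddCircle) := rfl
      rw [pow_succ', CircleDeg1Lift.mul_apply, h1, hh, ih, add_assoc, ← AddCircle.coe_add]
      congr 2
      push_cast
      ring
  have h1 := hsemi q x
  rw [mul_div_cancel₀ _ hq'] at h1
  have h2 : ((p : ℝ) : UnitAddCircle) = 0 := (AddCircle.coe_eq_zero_iff 1).2 ⟨p, by simp⟩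
  rw [h2, add_zero] at h1
  have h3 : (((f ^ q) x - x : ℝ) : UnitAddCircle) = 0 := by
    rw [AddCircle.coe_sub, h.injective h1, sub_self]
  obtain ⟨m, hm⟩ := (AddCircle.coe_eq_zero_iff 1).1 h3
  have hm' : (f ^ q) x = x + m := by
    simp only [zsmul_eq_mul, mul_one] at hm
    linarith
  -- The integer `m` may a priori depend on `x`; the rotation number `m / q = p / q` identifies it.
  have h4 := f.translationNumber_of_map_pow_eq_add_int hm' hq
  rw [hrot, div_left_inj' hq'] at h4
  rw [hm', h4]

end Iterates

/-! ### Itineraries and smooth branches of the `q`-th iterate -/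

section PiecewiseLinear

variable {n : ℕ} {I : Set ℝ} {b φ : ℤ → ℝ → ℝ} {F : ℝ → CircleDeg1Lift} {μ μc : ℝ}

namespace IsPWLFamily

/-- The lower bound survives iteration by monotonicity, the upper one by the Lipschitz bound on `F
μc`, at the cost of a geometric sum. -/
lemma eventually_pow_gap (hF : IsPWLFamily n I b φ F) (hI : IsOpen I) (hμc : μc ∈ I)
    (ht : IsTransverse b φ μc) {q : ℕ} (hq : 0 < q) :
    ∀ᶠ K : ℝ in atTop, ∀ᶠ μ in 𝓝[≠] μc, ∀ x,
      ((F μ ^ q) x - (F μc ^ q) x) / (μ - μc) ∈ Set.Icc (1 / K) K := by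
  obtain ⟨K₀, hK₀, hpos⟩ := ((hF.eventually_gap hI hμc ht).and (eventually_gt_atTop 0)).exists
  obtain ⟨Λ, hΛ, hlip⟩ := hF.exists_lipschitz hμc
  set s := ∑ i ∈ Finset.range q, Λ ^ i
  filter_upwards [eventually_ge_atTop K₀, eventually_ge_atTop (s * K₀)] with K hK1 hK2
  filter_upwards [hK₀, self_mem_nhdsWithin] with μ hμ hne x
  have hne' : μ - μc ≠ 0 := sub_ne_zero.2 hne
  have habs := abs_pos.2 hne'
  have hd : ∀ x, |F μ x - F μc x| ≤ K₀ * |μ - μc| := fun x => by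
    rw [← div_le_iff₀ habs, ← abs_div, abs_le]
    exact ⟨by linarith [(hμ x).1, one_div_pos.2 hpos], (hμ x).2⟩
  constructor
  · refine (one_div_le_one_div_of_le hpos hK1).trans ?_
    rcases lt_or_gt_of_ne hne' with h | h
    · rw [le_div_iff_of_neg h]
      have := CircleDeg1Lift.pow_add_le_pow (f := F μc) (g := F μ) (d := 1 / K₀ * -(μ - μc))
        (mul_nonneg (one_div_pos.2 hpos).le (by linarith))
        (fun x => by
          have := (le_div_iff_of_neg h).1 (hμ x).1
          linarith) hq x
      linarith
    · rw [le_div_iff₀ h]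
      have := CircleDeg1Lift.pow_add_le_pow (f := F μ) (g := F μc) (d := 1 / K₀ * (μ - μc))
        (mul_nonneg (one_div_pos.2 hpos).le h.le)
        (fun x => by
          have := (le_div_iff₀ h).1 (hμ x).1
          linarith) hq x
      linarith
  · refine (le_abs_self _).trans ?_
    rw [abs_div, div_le_iff₀ habs]
    refine (CircleDeg1Lift.abs_pow_sub_pow_le hΛ hlip hd q x).trans ?_
    rw [← mul_assoc]
    gcongr

lemma strictMono_pow (hF : IsPWLFamily n I b φ F) (hμ : μ ∈ I) (j : ℕ) :
    StrictMono (F μ ^ j : CircleDeg1Lift) := by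
  rw [CircleDeg1Lift.coe_pow]
  exact (hF.strictMono_lift μ hμ).iterate j

lemma breakOrbits_eq (f : CircleDeg1Lift) (c : ℤ → ℝ) (q : ℕ) :
    breakOrbits f c q = ⋃ j ∈ Finset.range q, (f ^ j : CircleDeg1Lift) ⁻¹' Set.range c := by
  ext x
  simp only [breakOrbits, Set.mem_ofPred_eq, Set.mem_iUnion, Finset.mem_range, Set.mem_preimage,
    Set.mem_range, exists_prop, eq_comm]

lemma countable_breakOrbits (hF : IsPWLFamily n I b φ F) (hμ : μ ∈ I) (q : ℕ) :
    (breakOrbits (F μ) (fun k => b k μ) q).Countable := by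
  rw [breakOrbits_eq]
  exact Set.Countable.biUnion (Finset.countable_toSet _) fun j _ =>
    (Set.countable_range _).preimage_of_injOn (hF.strictMono_pow hμ j).injective.injOn

lemma finite_range_break_inter (hF : IsPWLFamily n I b φ F) (hμ : μ ∈ I) (u v : ℝ) :
    (Set.range (fun k => b k μ) ∩ Set.Icc u v).Finite := by
  obtain ⟨k, hk⟩ := hF.exists_mem_Ico hμ u
  obtain ⟨m, hm⟩ := hF.exists_mem_Ico hμ v
  refine ((Set.finite_Icc k m).image fun k => b k μ).subset ?_
  rintro _ ⟨⟨i, rfl⟩, hi⟩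
  have hmono := hF.strictMono_break hμ
  have h1 := hmono.lt_iff_lt.1 (show b i μ < b (m + 1) μ from hi.2.trans_lt hm.2)
  exact ⟨i, ⟨hmono.le_iff_le.1 (show b k μ ≤ b i μ from hk.1.trans hi.1), by omega⟩, rfl⟩

lemma finite_breakOrbits_inter (hF : IsPWLFamily n I b φ F) (hμ : μ ∈ I) (q : ℕ) (u v : ℝ) :
    (breakOrbits (F μ) (fun k => b k μ) q ∩ Set.Icc u v).Finite := by
  rw [breakOrbits_eq, Set.iUnion₂_inter]
  refine Set.Finite.biUnion (Finset.finite_toSet _) fun j _ => ?_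
  have hmono := hF.strictMono_pow hμ j
  refine ((hF.finite_range_break_inter hμ ((F μ ^ j) u) ((F μ ^ j) v)).preimage
    hmono.injective.injOn).subset ?_
  rintro x ⟨hx, hux, hxv⟩
  exact ⟨hx, hmono.monotone hux, hmono.monotone hxv⟩

lemma add_one_mem_breakOrbits (hF : IsPWLFamily n I b φ F) (hμ : μ ∈ I) (q : ℕ) (x : ℝ) :
    x + 1 ∈ breakOrbits (F μ) (fun k => b k μ) q ↔ x ∈ breakOrbits (F μ) (fun k => b k μ) q := by
  constructor
  · rintro ⟨j, hj, k, hk⟩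
    refine ⟨j, hj, k - n, ?_⟩
    have := hF.break_periodic μ hμ (k - n)
    rw [sub_add_cancel] at this
    rw [CircleDeg1Lift.map_add_one] at hk
    simp only at hk ⊢
    linarith
  · rintro ⟨j, hj, k, hk⟩
    refine ⟨j, hj, k + n, ?_⟩
    have := hF.break_periodic μ hμ k
    rw [CircleDeg1Lift.map_add_one]
    simp only at hk ⊢
    linarith

/-- An interval free of points of the break orbits follows the pieces `κ 0, …, κ (q - 1)`. -/
def IsItinerary (F : ℝ → CircleDeg1Lift) (b : ℤ → ℝ → ℝ) (μ : ℝ) (q : ℕ) (l l' : ℝ)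
    (κ : ℕ → ℤ) : Prop :=
  ∀ j < q, b (κ j) μ ≤ (F μ ^ j) l ∧ (F μ ^ j) l' ≤ b (κ j + 1) μ

lemma exists_isItinerary (hF : IsPWLFamily n I b φ F) (hμ : μ ∈ I) {q : ℕ} {l l' : ℝ}
    (hll : l < l') (hdisj : Disjoint (Set.Ioo l l') (breakOrbits (F μ) (fun k => b k μ) q)) :
    ∃ κ, IsItinerary F b μ q l l' κ := by
  choose κ hκ using fun j : ℕ => hF.exists_mem_Ico hμ ((F μ ^ j) l)
  refine ⟨κ, fun j hj => ⟨(hκ j).1, ?_⟩⟩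
  -- If the image of `l'` passed the next break point, an interior point of the interval would map
  -- onto it and belong to the break orbits.
  by_contra! hlt
  obtain ⟨x, hx, hxb⟩ := intermediate_value_Ioo hll.le
    ((F μ).continuous_pow (hF.continuous_lift μ hμ) j).continuousOn
    (show b (κ j + 1) μ ∈ Set.Ioo _ _ from ⟨(hκ j).2, hlt⟩)
  exact Set.disjoint_left.1 hdisj hx ⟨j, hj, κ j + 1, hxb⟩

end IsPWLFamily

/-- The composition of the affine pieces `κ 0, …, κ (j - 1)`. -/
noncomputable def branch (b φ : ℤ → ℝ → ℝ) (κ : ℕ → ℤ) : ℕ → ℝ → ℝ → ℝ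
  | 0, _, x => x
  | j + 1, μ, x => affinePiece b φ (κ j) μ (branch b φ κ j μ x)

/-- The slope of `branch`. -/
noncomputable def branchSlope (b φ : ℤ → ℝ → ℝ) (κ : ℕ → ℤ) (j : ℕ) (μ : ℝ) : ℝ :=
  ∏ i ∈ Finset.range j, pieceSlope b φ (κ i) μ

lemma branch_sub_branch (b φ : ℤ → ℝ → ℝ) (κ : ℕ → ℤ) (j : ℕ) (μ x y : ℝ) :
    branch b φ κ j μ y - branch b φ κ j μ x = branchSlope b φ κ j μ * (y - x) := by
  induction j with
  | zero => simp [branch, branchSlope]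
  | succ j ih =>
    rw [branchSlope, Finset.prod_range_succ, ← branchSlope, mul_right_comm, ← ih]
    simp only [branch, affinePiece]
    ring

namespace IsPWLFamily

variable {κ : ℕ → ℤ} {q : ℕ} {l l' : ℝ} {p : ℤ}

lemma contDiffAt_branch (hF : IsPWLFamily n I b φ F) (hI : IsOpen I) (hμ : μ ∈ I) (j : ℕ)
    (x : ℝ) : ContDiffAt ℝ 2 (fun ν => branch b φ κ j ν x) μ := by
  induction j with
  | zero => exact contDiffAt_const
  | succ j ih =>
    exact (hF.contDiffAt_value hI hμ _).add
      ((hF.contDiffAt_slope hI hμ _).mul (ih.sub (hF.contDiffAt_break hI hμ _)))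

lemma contDiffAt_branchSlope (hF : IsPWLFamily n I b φ F) (hI : IsOpen I) (hμ : μ ∈ I) (j : ℕ) :
    ContDiffAt ℝ 2 (branchSlope b φ κ j) μ :=
  contDiffAt_prod fun i _ => hF.contDiffAt_slope hI hμ (κ i)

lemma branchSlope_pos (hF : IsPWLFamily n I b φ F) (hμ : μ ∈ I) (j : ℕ) :
    0 < branchSlope b φ κ j μ :=
  Finset.prod_pos fun i _ => hF.slope_pos hμ (κ i)

/-- The condition concerns the branch values, which are smooth in `μ`, so it can be checked by
calculus at nearby parameters. -/
lemma pow_eq_branch (hF : IsPWLFamily n I b φ F) (hμ : μ ∈ I) {x : ℝ} {j : ℕ}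
    (h : ∀ i < j, branch b φ κ i μ x ∈ Set.Icc (b (κ i) μ) (b (κ i + 1) μ)) :
    (F μ ^ j) x = branch b φ κ j μ x := by
  induction j with
  | zero => simp [branch]
  | succ j ih =>
    rw [pow_succ', CircleDeg1Lift.mul_apply, ih fun i hi => h i (by omega),
      hF.map_eq_affinePiece hμ (h j (by omega)), branch]

lemma IsItinerary.pow_mem (hκ : IsItinerary F b μ q l l' κ) {x : ℝ} (hx : x ∈ Set.Icc l l')
    {j : ℕ} (hj : j < q) : (F μ ^ j) x ∈ Set.Icc (b (κ j) μ) (b (κ j + 1) μ) :=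
  ⟨(hκ j hj).1.trans ((F μ ^ j).mono hx.1), ((F μ ^ j).mono hx.2).trans (hκ j hj).2⟩

lemma IsItinerary.pow_eq_branch (hκ : IsItinerary F b μ q l l' κ)
    (hF : IsPWLFamily n I b φ F) (hμ : μ ∈ I) {x : ℝ} (hx : x ∈ Set.Icc l l')
    {j : ℕ} (hj : j ≤ q) : (F μ ^ j) x = branch b φ κ j μ x := by
  induction j with
  | zero => simp [branch]
  | succ j ih =>
    rw [pow_succ', CircleDeg1Lift.mul_apply, hF.map_eq_affinePiece hμ (hκ.pow_mem hx hj),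
      ih (by omega), branch]

/-- Each piece moves upwards, on its whole closed domain. -/
lemma piece_speed_pos (hF : IsPWLFamily n I b φ F) (hI : IsOpen I) (hμc : μc ∈ I)
    (ht : IsTransverse b φ μc) {k : ℤ} {y : ℝ} (hy : y ∈ Set.Icc (b k μc) (b (k + 1) μc)) :
    0 < deriv (φ k) μc + deriv (pieceSlope b φ k) μc * (y - b k μc) +
      pieceSlope b φ k μc * (0 - deriv (b k) μc) := by
  have h1 := hF.hasDerivAt_vertex hI hμc k k (hasDerivAt_const μc y)
  have h2 := hF.hasDerivAt_vertex hI hμc k (k + 1) (hasDerivAt_const μc y)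
  have e := (h1.congr_of_eventuallyEq (by
    filter_upwards [hI.mem_nhds hμc] with ν hν
    exact (hF.affinePiece_eq_right hν k y).symm)).unique h2
  have p1 := ht.pos_right k
  have p2 := ht.pos_left (k + 1)
  rw [add_sub_cancel_right] at p2
  -- The speed is affine in `y` and positive at both ends; the sign of `s_k'` decides from which end
  -- to estimate.
  rcases le_total 0 (deriv (pieceSlope b φ k) μc) with hs | hs
  · have := mul_nonneg hs (sub_nonneg.2 hy.1)
    linarith
  · rw [e]
    have := mul_nonneg_of_nonpos_of_nonpos hs (sub_nonpos.2 hy.2)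
    linarith

/-- By the chain rule the new speed is the speed of the current piece, which is positive, plus its
slope times the previous speed, which is nonnegative. -/
lemma IsItinerary.deriv_branch_nonneg (hκ : IsItinerary F b μc q l l' κ)
    (hF : IsPWLFamily n I b φ F) (hI : IsOpen I) (hμc : μc ∈ I) (ht : IsTransverse b φ μc)
    {x : ℝ} (hx : x ∈ Set.Icc l l') {j : ℕ} (hj : j ≤ q) :
    0 ≤ deriv (fun ν => branch b φ κ j ν x) μc ∧
      (0 < j → 0 < deriv (fun ν => branch b φ κ j ν x) μc) := by
  induction j with
  | zero => simp [branch]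
  | succ j ih =>
    have hd := ((hF.contDiffAt_branch (κ := κ) hI hμc j x).differentiableAt
      two_ne_zero).hasDerivAt
    have h1 := hF.hasDerivAt_vertex hI hμc (κ j) (κ j) hd
    have h2 : deriv (fun ν => branch b φ κ (j + 1) ν x) μc = _ := h1.deriv
    have hmem := hκ.pow_mem hx hj
    rw [hκ.pow_eq_branch hF hμc hx (by omega)] at hmem
    have h3 := hF.piece_speed_pos hI hμc ht hmem
    have h4 := mul_nonneg (hF.slope_pos hμc (κ j)).le (ih (by omega)).1
    have h5 : 0 < deriv (fun ν => branch b φ κ (j + 1) ν x) μc := by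
      rw [h2]
      linarith
    exact ⟨h5.le, fun _ => h5⟩

lemma IsItinerary.deriv_branch_pos (hκ : IsItinerary F b μc q l l' κ)
    (hF : IsPWLFamily n I b φ F) (hI : IsOpen I) (hμc : μc ∈ I) (ht : IsTransverse b φ μc)
    (hq : 0 < q) {x : ℝ} (hx : x ∈ Set.Icc l l') :
    0 < deriv (fun ν => branch b φ κ q ν x) μc :=
  (hκ.deriv_branch_nonneg hF hI hμc ht hx le_rfl).2 hq

/-- Away from the ends of the interval the itinerary persists. -/
lemma IsItinerary.eventually_pow_eq_branch (hκ : IsItinerary F b μc q l l' κ)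
    (hF : IsPWLFamily n I b φ F) (hI : IsOpen I) (hμc : μc ∈ I) (hll : l ≤ l') :
    ∀ᶠ γ : ℝ in atTop, ∀ᶠ μ in 𝓝 μc,
      ∀ x ∈ Set.Icc (l + γ * |μ - μc|) (l' - γ * |μ - μc|),
        (F μ ^ q) x = branch b φ κ q μ x := by
  have hdiff : ∀ (j : ℕ) (x : ℝ), DifferentiableAt ℝ (fun ν => branch b φ κ j ν x) μc :=
    fun j x => (hF.contDiffAt_branch hI hμc j x).differentiableAt two_ne_zero
  have hdb : ∀ k, DifferentiableAt ℝ (b k) μc :=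
    fun k => (hF.contDiffAt_break hI hμc k).differentiableAt two_ne_zero
  -- At `μc` an image of `l` may sit exactly on a break point. Moving inwards by `γ|μ - μc|` gains
  -- `branchSlope` times that amount, which beats the drift of the end points once `γ` is large.
  have hleft := (eventually_all_finset (Finset.range q)).2 fun j hj =>
    eventually_add_mul_abs_nonneg ((hdiff j l).sub (hdb (κ j)))
      (hF.contDiffAt_branchSlope (κ := κ) hI hμc j).continuousAt
      (by
        have := (hκ j (Finset.mem_range.1 hj)).1
        rw [hκ.pow_eq_branch hF hμc ⟨le_rfl, hll⟩ (Finset.mem_range.1 hj).le] at this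
        simpa using this)
      (hF.branchSlope_pos hμc j)
  have hright := (eventually_all_finset (Finset.range q)).2 fun j hj =>
    eventually_add_mul_abs_nonneg ((hdb (κ j + 1)).sub (hdiff j l'))
      (hF.contDiffAt_branchSlope (κ := κ) hI hμc j).continuousAt
      (by
        have := (hκ j (Finset.mem_range.1 hj)).2
        rw [hκ.pow_eq_branch hF hμc ⟨hll, le_rfl⟩ (Finset.mem_range.1 hj).le] at this
        simpa using this)
      (hF.branchSlope_pos hμc j)
  filter_upwards [hleft, hright] with γ h1 h2
  filter_upwards [(eventually_all_finset _).2 h1, (eventually_all_finset _).2 h2,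
    hI.mem_nhds hμc] with μ h3 h4 hμ x hx
  refine hF.pow_eq_branch hμ fun j hj => ?_
  have h5 := h3 j (Finset.mem_range.2 hj)
  have h6 := h4 j (Finset.mem_range.2 hj)
  simp only [Pi.sub_apply] at h5 h6
  have hS := (hF.branchSlope_pos (κ := κ) hμ j).le
  have h7 := branch_sub_branch b φ κ j μ l x
  have h8 := branch_sub_branch b φ κ j μ x l'
  have h9 := mul_le_mul_of_nonneg_left (show γ * |μ - μc| ≤ x - l by linarith [hx.1]) hS
  have h10 := mul_le_mul_of_nonneg_left (show γ * |μ - μc| ≤ l' - x by linarith [hx.2]) hS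
  constructor <;> linarith

lemma IsItinerary.branchSlope_eq_one (hκ : IsItinerary F b μc q l l' κ)
    (hF : IsPWLFamily n I b φ F) (hμc : μc ∈ I) (hll : l < l')
    (hper : ∀ x, (F μc ^ q) x = x + p) : branchSlope b φ κ q μc = 1 := by
  have := branch_sub_branch b φ κ q μc l l'
  rw [← hκ.pow_eq_branch hF hμc ⟨le_rfl, hll.le⟩ le_rfl,
    ← hκ.pow_eq_branch hF hμc ⟨hll.le, le_rfl⟩ le_rfl, hper, hper,
    add_sub_add_right_eq_sub] at this
  exact mul_right_cancel₀ (sub_pos.2 hll).ne' (by linarith)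

lemma IsItinerary.isBigO_branch (hκ : IsItinerary F b μc q l l' κ)
    (hF : IsPWLFamily n I b φ F) (hI : IsOpen I) (hμc : μc ∈ I) (hll : l < l')
    (hper : ∀ x, (F μc ^ q) x = x + p) :
    (fun μ => branch b φ κ q μ l - p - l - deriv (fun ν => branch b φ κ q ν l) μc * (μ - μc))
      =O[𝓝 μc] (fun μ => (μ - μc) ^ 2) := by
  have := (hF.contDiffAt_branch (κ := κ) hI hμc q l).isBigO_sub_sub_deriv_mul
  rw [← hκ.pow_eq_branch hF hμc ⟨le_rfl, hll.le⟩ le_rfl, hper] at this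
  refine this.congr_left fun μ => ?_
  ring

lemma IsItinerary.isBigO_branchSlope (hκ : IsItinerary F b μc q l l' κ)
    (hF : IsPWLFamily n I b φ F) (hI : IsOpen I) (hμc : μc ∈ I) (hll : l < l')
    (hper : ∀ x, (F μc ^ q) x = x + p) :
    (fun μ => branchSlope b φ κ q μ - 1 - deriv (branchSlope b φ κ q) μc * (μ - μc))
      =O[𝓝 μc] (fun μ => (μ - μc) ^ 2) := by
  have := (hF.contDiffAt_branchSlope (κ := κ) hI hμc q).isBigO_sub_sub_deriv_mul
  rwa [hκ.branchSlope_eq_one hF hμc hll hper] at this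

theorem IsItinerary.hasLaminarCoeffs (hκ : IsItinerary F b μc q l l' κ)
    (hF : IsPWLFamily n I b φ F) (hI : IsOpen I) (hμc : μc ∈ I) (hll : l < l')
    (hper : ∀ x, (F μc ^ q) x = x + p) :
    HasLaminarCoeffs (fun μ x => (F μ ^ q) x - (p : ℝ)) μc l l'
      (deriv (fun ν => branch b φ κ q ν l) μc) (deriv (branchSlope b φ κ q) μc) := by
  obtain ⟨γ, hγ, hpos⟩ := ((hκ.eventually_pow_eq_branch hF hI hμc hll.le).and
    (eventually_gt_atTop 0)).exists
  refine ⟨γ, hpos, branchSlope b φ κ q, ?_, ?_, hκ.isBigO_branchSlope hF hI hμc hll hper⟩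
  · filter_upwards [hγ] with μ h x hx
    rw [h x hx, h _ ⟨le_rfl, hx.1.trans hx.2⟩]
    have := branch_sub_branch b φ κ q μ (l + γ * |μ - μc|) x
    linarith
  -- Moving the base point from `l` to `l + γ|μ - μc|` changes the displacement by this product of
  -- two `O(μ - μc)` factors, so `A` can be computed at `l`.
  · have hO : (fun μ => (branchSlope b φ κ q μ - 1) * (γ * |μ - μc|))
        =O[𝓝 μc] (fun μ => (μ - μc) ^ 2) := by
      have h1 := ((hF.contDiffAt_branchSlope (κ := κ) hI hμc q).differentiableAt
        two_ne_zero).isBigO_sub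
      rw [hκ.branchSlope_eq_one hF hμc hll hper] at h1
      have h2 : (fun μ => γ * |μ - μc|) =O[𝓝 μc] (fun μ => μ - μc) :=
        (isBigO_refl (fun μ => μ - μc) (𝓝 μc)).abs_left.const_mul_left γ
      exact (h1.mul h2).congr_right fun μ => (sq _).symm
    refine ((hκ.isBigO_branch hF hI hμc hll hper).add hO).congr' ?_ EventuallyEq.rfl
    have hsmall : ∀ᶠ μ in 𝓝 μc, l + γ * |μ - μc| < l' - γ * |μ - μc| := by
      refine ContinuousAt.eventually_lt (by fun_prop) (by fun_prop) ?_
      simpa using hll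
    filter_upwards [hγ, hsmall] with μ h hlt
    rw [h _ ⟨le_rfl, hlt.le⟩]
    have := branch_sub_branch b φ κ q μ l (l + γ * |μ - μc|)
    linarith

/-- The displacement is affine in `x`, so the expansions at `l` and of the slope give a bound
uniform over the cell. The same `K` serves as margin and as error constant. -/
theorem IsItinerary.eventually_abs_step_sub_le (hκ : IsItinerary F b μc q l l' κ)
    (hF : IsPWLFamily n I b φ F) (hI : IsOpen I) (hμc : μc ∈ I) (hll : l < l')
    (hper : ∀ x, (F μc ^ q) x = x + p) :
    ∀ᶠ K : ℝ in atTop, ∀ᶠ μ in 𝓝 μc,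
      ∀ x ∈ Set.Icc (l + K * |μ - μc|) (l' - K * |μ - μc|),
        |(F μ ^ q) x - p - x - (μ - μc) * (deriv (fun ν => branch b φ κ q ν l) μc +
          deriv (branchSlope b φ κ q) μc * (x - l))| ≤ K * (μ - μc) ^ 2 := by
  obtain ⟨C₁, hC₁⟩ := (hκ.isBigO_branch hF hI hμc hll hper).bound
  obtain ⟨C₂, hC₂⟩ := (hκ.isBigO_branchSlope hF hI hμc hll hper).bound
  filter_upwards [hκ.eventually_pow_eq_branch hF hI hμc hll.le, eventually_ge_atTop 0,
    eventually_ge_atTop (C₁ + C₂ * (l' - l))] with K hK hK0 hKC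
  filter_upwards [hC₁, hC₂, hK] with μ h1 h2 h3 x hx
  rw [h3 x hx]
  have hxl : 0 ≤ x - l := by
    have : 0 ≤ K * |μ - μc| := by positivity
    linarith [hx.1]
  have hxl' : x - l ≤ l' - l := by
    have : 0 ≤ K * |μ - μc| := by positivity
    linarith [hx.2]
  have e := branch_sub_branch b φ κ q μ l x
  simp only [Real.norm_eq_abs, abs_pow, sq_abs] at h1 h2
  have h4 : |(branchSlope b φ κ q μ - 1 - deriv (branchSlope b φ κ q) μc * (μ - μc)) * (x - l)|
      ≤ C₂ * (μ - μc) ^ 2 * (l' - l) := by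
    rw [abs_mul, abs_of_nonneg hxl]
    exact mul_le_mul h2 hxl' hxl ((abs_nonneg _).trans h2)
  calc _ = |(branch b φ κ q μ l - p - l - deriv (fun ν => branch b φ κ q ν l) μc * (μ - μc)) +
        (branchSlope b φ κ q μ - 1 - deriv (branchSlope b φ κ q) μc * (μ - μc)) * (x - l)| := by
        congr 1
        linarith
    _ ≤ C₁ * (μ - μc) ^ 2 + C₂ * (μ - μc) ^ 2 * (l' - l) :=
        (abs_add_le _ _).trans (add_le_add h1 h4)
    _ = (C₁ + C₂ * (l' - l)) * (μ - μc) ^ 2 := by ring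
    _ ≤ K * (μ - μc) ^ 2 := by gcongr

end IsPWLFamily

end PiecewiseLinear

/-! ### Cells of a period, the velocity field and its crossing time -/

section Enumeration

open MeasureTheory

lemma exists_isPeriodEnumeration {L : Set ℝ} {a : ℝ} (ha : a ∈ L) (ha' : a + 1 ∈ L)
    (hfin : (L ∩ Set.Icc a (a + 1)).Finite) : ∃ N ℓ, IsPeriodEnumeration L N ℓ := by
  set S : Finset ℝ := hfin.toFinset
  have memS : ∀ x, x ∈ S ↔ x ∈ L ∩ Set.Icc a (a + 1) := fun x => hfin.mem_toFinset
  have haS : a ∈ S := (memS a).2 ⟨ha, le_rfl, by linarith⟩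
  have haS' : a + 1 ∈ S := (memS _).2 ⟨ha', by linarith, le_rfl⟩
  have hne : S.Nonempty := ⟨a, haS⟩
  obtain ⟨N, hN⟩ : ∃ N, S.card = N + 1 := Nat.exists_eq_succ_of_ne_zero hne.card_pos.ne'
  set e := S.orderEmbOfFin hN
  have he0 : e 0 = a := by
    have : e 0 = S.min' hne := Finset.orderEmbOfFin_zero hN (Nat.succ_pos N)
    rw [this]
    exact le_antisymm (Finset.min'_le _ _ haS)
      (Finset.le_min' _ _ _ fun y hy => ((memS y).1 hy).2.1)
  have heN : e (Fin.last N) = a + 1 := by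
    have : e (Fin.last N) = S.max' hne := Finset.orderEmbOfFin_last hN (Nat.succ_pos N)
    rw [this]
    exact le_antisymm (Finset.max'_le _ _ _ fun y hy => ((memS y).1 hy).2.2)
      (Finset.le_max' _ _ haS')
  have hval : ∀ i (hi : i < N + 1), e (Fin.ofNat (N + 1) i) = e ⟨i, hi⟩ := fun i hi => by
    congr 1
    ext
    simp [Nat.mod_eq_of_lt hi]
  have h0 : e (Fin.ofNat (N + 1) 0) = a := he0
  have hl : e (Fin.ofNat (N + 1) N) = a + 1 := by
    rw [hval N (Nat.lt_succ_self N)]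
    exact heN
  -- Indices beyond `N` wrap around; their values are never used.
  refine ⟨N, fun i => e (Fin.ofNat (N + 1) i), ?_, ?_, ?_⟩
  · intro i hi j hj hij
    change e (Fin.ofNat (N + 1) i) < e (Fin.ofNat (N + 1) j)
    rw [hval i (Nat.lt_succ_of_le hi), hval j (Nat.lt_succ_of_le hj)]
    exact e.strictMono hij
  · rw [h0, hl]
  · rw [h0, hl]
    ext x
    rw [← memS x, ← Finset.mem_coe, ← Finset.range_orderEmbOfFin S hN]
    constructor
    · rintro ⟨i, _, rfl⟩
      exact ⟨_, rfl⟩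
    · rintro ⟨i, rfl⟩
      refine ⟨i, Nat.lt_succ_iff.1 i.2, ?_⟩
      exact hval i i.2

namespace IsPeriodEnumeration

variable {L : Set ℝ} {N : ℕ} {ℓ : ℕ → ℝ}

lemma pos (hE : IsPeriodEnumeration L N ℓ) : 0 < N := by
  rcases Nat.eq_zero_or_pos N with rfl | h
  · have := hE.last_eq
    linarith
  · exact h

lemma lt_succ (hE : IsPeriodEnumeration L N ℓ) {i : ℕ} (hi : i < N) : ℓ i < ℓ (i + 1) :=
  hE.strictMonoOn (Set.mem_Iic.2 hi.le) (Set.mem_Iic.2 hi) (Nat.lt_succ_self i)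

lemma mem (hE : IsPeriodEnumeration L N ℓ) {i : ℕ} (hi : i ≤ N) : ℓ i ∈ L :=
  (hE.image_eq ▸ Set.mem_image_of_mem ℓ (Set.mem_Iic.2 hi) :
    ℓ i ∈ L ∩ Set.Icc (ℓ 0) (ℓ N)).1

lemma mono (hE : IsPeriodEnumeration L N ℓ) {i j : ℕ} (hij : i ≤ j) (hj : j ≤ N) : ℓ i ≤ ℓ j :=
  hE.strictMonoOn.monotoneOn (Set.mem_Iic.2 (hij.trans hj)) (Set.mem_Iic.2 hj) hij

lemma disjoint_Ioo (hE : IsPeriodEnumeration L N ℓ) {i : ℕ} (hi : i < N) :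
    Disjoint (Set.Ioo (ℓ i) (ℓ (i + 1))) L := by
  rw [Set.disjoint_left]
  intro x hx hxL
  have hmem : x ∈ L ∩ Set.Icc (ℓ 0) (ℓ N) :=
    ⟨hxL, (hE.mono (Nat.zero_le i) hi.le).trans hx.1.le, hx.2.le.trans (hE.mono hi le_rfl)⟩
  rw [← hE.image_eq] at hmem
  obtain ⟨j, hj, rfl⟩ := hmem
  rcases le_or_gt j i with h | h
  · exact absurd hx.1 (not_lt.2 (hE.mono h hi.le))
  · exact absurd hx.2 (not_lt.2 (hE.mono h hj))

/-- Every point lies in a translate of one of the cells. -/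
lemma exists_cell (hE : IsPeriodEnumeration L N ℓ) (x : ℝ) :
    ∃ (m : ℤ) (i : ℕ), i < N ∧ x - m ∈ Set.Ico (ℓ i) (ℓ (i + 1)) := by
  obtain ⟨m, hm, -⟩ := existsUnique_sub_zsmul_mem_Ico (zero_lt_one' ℝ) x (ℓ 0)
  simp only [zsmul_eq_mul, mul_one] at hm
  rw [← hE.last_eq] at hm
  refine ⟨m, ?_⟩
  have key : ∀ j ≤ N, x - m < ℓ j → ∃ i < N, x - m ∈ Set.Ico (ℓ i) (ℓ (i + 1)) := by
    intro j
    induction j with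
    | zero => exact fun _ h => absurd h (not_lt.2 hm.1)
    | succ j ih =>
      intro hj h
      rcases lt_or_ge (x - m) (ℓ j) with h' | h'
      · exact ih (by omega) h'
      · exact ⟨j, hj, h', h⟩
  exact key N le_rfl hm.2

lemma cell_unique (hE : IsPeriodEnumeration L N ℓ) {x : ℝ} {m m' : ℤ} {i i' : ℕ}
    (hi : i < N) (hi' : i' < N) (hx : x - m ∈ Set.Ico (ℓ i) (ℓ (i + 1)))
    (hx' : x - m' ∈ Set.Ico (ℓ i') (ℓ (i' + 1))) : m = m' ∧ i = i' := by
  have hper : ∀ {k : ℤ} {j : ℕ}, j < N → x - k ∈ Set.Ico (ℓ j) (ℓ (j + 1)) →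
      x - k • (1 : ℝ) ∈ Set.Ico (ℓ 0) (ℓ 0 + 1) := by
    intro k j hj hk
    rw [← hE.last_eq]
    simp only [zsmul_eq_mul, mul_one]
    exact ⟨(hE.mono (Nat.zero_le j) hj.le).trans hk.1, hk.2.trans_le (hE.mono hj le_rfl)⟩
  have hm : m = m' := (existsUnique_sub_zsmul_mem_Ico (zero_lt_one' ℝ) x (ℓ 0)).unique
    (hper hi hx) (hper hi' hx')
  subst hm
  refine ⟨rfl, ?_⟩
  rcases lt_trichotomy i i' with h | h | h
  · exact absurd (hx.2.trans_le (hE.mono h hi'.le)) (not_lt.2 hx'.1)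
  · exact h
  · exact absurd (hx'.2.trans_le (hE.mono h hi.le)) (not_lt.2 hx.1)

end IsPeriodEnumeration

lemma add_int_mem_iff {L : Set ℝ} (hL : ∀ x, x + 1 ∈ L ↔ x ∈ L) (x : ℝ) (m : ℤ) :
    x + m ∈ L ↔ x ∈ L := by
  induction m with
  | zero => simp
  | succ m ih =>
    rw [← ih, ← hL (x + ((m : ℤ) : ℝ))]
    push_cast
    rw [add_assoc]
  | pred m ih =>
    rw [← ih, ← hL (x + _)]
    push_cast
    rw [show x + (-(m : ℝ) - 1) + 1 = x + -(m : ℝ) by ring]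

lemma affine_pos {A B d t : ℝ} (hA : 0 < A) (hB : 0 < A + B * d) (ht : t ∈ Set.Icc 0 d) :
    0 < A + B * t := by
  rcases le_total 0 B with h | h
  · have := mul_nonneg h ht.1
    linarith
  · have := mul_le_mul_of_nonpos_left ht.2 h
    linarith

lemma intervalIntegrable_inv_affine {l l' A B : ℝ} (hll : l ≤ l') (hA : 0 < A)
    (hB : 0 < A + B * (l' - l)) :
    IntervalIntegrable (fun x => (A + B * (x - l))⁻¹) volume l l' := by
  refine ContinuousOn.intervalIntegrable (ContinuousOn.inv₀ (by fun_prop) fun x hx => ?_)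
  rw [Set.uIcc_of_le hll] at hx
  exact (affine_pos hA hB ⟨sub_nonneg.2 hx.1, sub_le_sub_right hx.2 l⟩).ne'

/-- The coefficient `kappa` is the time needed to cross a cell. -/
lemma integral_inv_affine {l l' A B : ℝ} (hll : l ≤ l') (hA : 0 < A)
    (hB : 0 < A + B * (l' - l)) :
    ∫ x in l..l', (A + B * (x - l))⁻¹ = kappa (l' - l) A B := by
  unfold kappa
  split_ifs with h
  · subst h
    simp [div_eq_mul_inv]
  · have hd : ∀ x ∈ Set.uIcc l l', HasDerivAt (fun x => 1 / B * Real.log (A + B * (x - l)))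
        (A + B * (x - l))⁻¹ x := by
      intro x hx
      rw [Set.uIcc_of_le hll] at hx
      have hpos := affine_pos hA hB ⟨sub_nonneg.2 hx.1, sub_le_sub_right hx.2 l⟩
      have h1 : HasDerivAt (fun x => A + B * (x - l)) (B * 1) x :=
        (((hasDerivAt_id x).sub_const l).const_mul B).const_add A
      convert! (h1.log hpos.ne').const_mul (1 / B) using 1
      field_simp
    rw [intervalIntegral.integral_eq_sub_of_hasDerivAt hd
      (intervalIntegrable_inv_affine hll hA hB), sub_self, mul_zero, add_zero, ← mul_sub,
      ← Real.log_div hB.ne' hA.ne']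
    congr 2
    field_simp

namespace IsPeriodEnumeration

variable {L : Set ℝ} {N : ℕ} {ℓ A B : ℕ → ℝ}

/-- The translation and the index of the cell containing a point. -/
noncomputable def cell (hE : IsPeriodEnumeration L N ℓ) (x : ℝ) : ℤ × ℕ :=
  ((hE.exists_cell x).choose, (hE.exists_cell x).choose_spec.choose)

lemma cell_spec (hE : IsPeriodEnumeration L N ℓ) (x : ℝ) : (hE.cell x).2 < N ∧
    x - (hE.cell x).1 ∈ Set.Ico (ℓ (hE.cell x).2) (ℓ ((hE.cell x).2 + 1)) :=
  (hE.exists_cell x).choose_spec.choose_spec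

/-- The periodic velocity field which is affine on each cell. -/
noncomputable def velocity (hE : IsPeriodEnumeration L N ℓ) (A B : ℕ → ℝ) (x : ℝ) : ℝ :=
  A (hE.cell x).2 + B (hE.cell x).2 * (x - (hE.cell x).1 - ℓ (hE.cell x).2)

lemma velocity_eq (hE : IsPeriodEnumeration L N ℓ) {x : ℝ} {m : ℤ} {i : ℕ} (hi : i < N)
    (hx : x - m ∈ Set.Ico (ℓ i) (ℓ (i + 1))) :
    hE.velocity A B x = A i + B i * (x - m - ℓ i) := by
  obtain ⟨h1, h2⟩ := hE.cell_unique (hE.cell_spec x).1 hi (hE.cell_spec x).2 hx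
  rw [velocity, h1, h2]

lemma periodic_velocity (hE : IsPeriodEnumeration L N ℓ) :
    Function.Periodic (hE.velocity A B) 1 := by
  intro x
  obtain ⟨m, i, hi, hx⟩ := hE.exists_cell x
  have e : x + 1 - ((m + 1 : ℤ) : ℝ) = x - m := by push_cast; ring
  rw [hE.velocity_eq hi hx, hE.velocity_eq (x := x + 1) (m := m + 1) hi (by rwa [e]), e]

/-- The open interval is needed: at its right end the velocity already follows the next cell.
Integrals do not see this. -/
lemma eqOn_velocity (hE : IsPeriodEnumeration L N ℓ) {i : ℕ} (hi : i < N) :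
    Set.EqOn (fun x => (A i + B i * (x - ℓ i))⁻¹) (fun x => (hE.velocity A B x)⁻¹)
      (Set.uIoo (ℓ i) (ℓ (i + 1))) := by
  intro x hx
  rw [Set.uIoo_of_lt (hE.lt_succ hi)] at hx
  simp only
  rw [hE.velocity_eq (m := 0) hi (by simpa using ⟨hx.1.le, hx.2⟩)]
  simp

lemma intervalIntegrable_cell (hE : IsPeriodEnumeration L N ℓ) {i : ℕ} (hi : i < N)
    (hA : 0 < A i) (hB : 0 < A i + B i * (ℓ (i + 1) - ℓ i)) :
    IntervalIntegrable (fun x => (hE.velocity A B x)⁻¹) volume (ℓ i) (ℓ (i + 1)) :=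
  (intervalIntegrable_inv_affine (hE.lt_succ hi).le hA hB).congr_uIoo (hE.eqOn_velocity hi)

lemma intervalIntegrable_velocity (hE : IsPeriodEnumeration L N ℓ) (hA : ∀ i < N, 0 < A i)
    (hB : ∀ i < N, 0 < A i + B i * (ℓ (i + 1) - ℓ i)) (u w : ℝ) :
    IntervalIntegrable (fun x => (hE.velocity A B x)⁻¹) volume u w := by
  have hper : Function.Periodic (fun x => (hE.velocity A B x)⁻¹) 1 := fun x => by
    simp only [hE.periodic_velocity x]
  refine hper.intervalIntegrable one_ne_zero (t := ℓ 0) ?_ u w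
  rw [← hE.last_eq]
  exact IntervalIntegrable.trans_iterate fun i hi =>
    hE.intervalIntegrable_cell hi (hA i hi) (hB i hi)

lemma integral_velocity (hE : IsPeriodEnumeration L N ℓ) (hA : ∀ i < N, 0 < A i)
    (hB : ∀ i < N, 0 < A i + B i * (ℓ (i + 1) - ℓ i)) :
    ∫ x in (0 : ℝ)..1, (hE.velocity A B x)⁻¹ =
      ∑ i ∈ Finset.range N, kappa (ℓ (i + 1) - ℓ i) (A i) (B i) := by
  have hper : Function.Periodic (fun x => (hE.velocity A B x)⁻¹) 1 := fun x => by
    simp only [hE.periodic_velocity x]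
  have h1 := hper.intervalIntegral_add_eq 0 (ℓ 0)
  rw [zero_add, ← hE.last_eq] at h1
  rw [h1, ← intervalIntegral.sum_integral_adjacent_intervals (a := ℓ) fun i hi =>
    hE.intervalIntegrable_cell hi (hA i hi) (hB i hi)]
  refine Finset.sum_congr rfl fun i hi => ?_
  rw [Finset.mem_range] at hi
  rw [← integral_inv_affine (hE.lt_succ hi).le (hA i hi) (hB i hi)]
  exact (intervalIntegral.integral_congr_uIoo (hE.eqOn_velocity hi)).symm

theorem eventually_isVelocity (hE : IsPeriodEnumeration L N ℓ) (hL : ∀ x, x + 1 ∈ L ↔ x ∈ L)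
    (hA : ∀ i < N, 0 < A i) (hB : ∀ i < N, 0 < A i + B i * (ℓ (i + 1) - ℓ i)) :
    ∀ᶠ K in atTop, IsVelocity L (hE.velocity A B) K := by
  have hinv : Tendsto (fun K : ℝ => 1 / K) atTop (𝓝 0) := by
    simpa using tendsto_inv_atTop_zero (𝕜 := ℝ)
  have hcell := (eventually_all_finset (Finset.range N)).2 fun i hi =>
    (hinv.eventually (gt_mem_nhds (hA i (Finset.mem_range.1 hi)))).and <|
    (hinv.eventually (gt_mem_nhds (hB i (Finset.mem_range.1 hi)))).and <|
    (eventually_ge_atTop (A i)).and <|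
    (eventually_ge_atTop (A i + B i * (ℓ (i + 1) - ℓ i))).and (eventually_ge_atTop |B i|)
  filter_upwards [hcell, eventually_ge_atTop 0] with K hK hK0
  have hbound : ∀ x, hE.velocity A B x ∈ Set.Icc (1 / K) K := by
    intro x
    obtain ⟨m, i, hi, hx⟩ := hE.exists_cell x
    obtain ⟨k1, k2, k3, k4, -⟩ := hK i (Finset.mem_range.2 hi)
    rw [hE.velocity_eq hi hx]
    rcases le_total 0 (B i) with h | h
    · have h1 := mul_nonneg h (sub_nonneg.2 hx.1)
      have h2 := mul_le_mul_of_nonneg_left (sub_le_sub_right hx.2.le (ℓ i)) h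
      constructor <;> linarith
    · have h1 := mul_nonpos_of_nonpos_of_nonneg h (sub_nonneg.2 hx.1)
      have h2 := mul_le_mul_of_nonpos_left (sub_le_sub_right hx.2.le (ℓ i)) h
      constructor <;> linarith
  have hlip : ∀ x y, x ≤ y → Disjoint (Set.Icc x y) L →
      |hE.velocity A B x - hE.velocity A B y| ≤ K * |x - y| := by
    intro x y hxy hdisj
    obtain ⟨m, i, hi, hx⟩ := hE.exists_cell x
    -- An interval missing `L` stays in one cell, since otherwise it would contain a translate of `ℓ
    -- (i + 1)`.
    have hy : y - m ∈ Set.Ico (ℓ i) (ℓ (i + 1)) := by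
      refine ⟨by linarith [hx.1], ?_⟩
      by_contra! hlt
      exact Set.disjoint_left.1 hdisj ⟨by linarith [hx.2], by linarith⟩
        ((add_int_mem_iff hL _ m).2 (hE.mem hi))
    obtain ⟨-, -, -, -, k5⟩ := hK i (Finset.mem_range.2 hi)
    rw [hE.velocity_eq hi hx, hE.velocity_eq hi hy,
      show A i + B i * (x - m - ℓ i) - (A i + B i * (y - m - ℓ i)) = B i * (x - y) by ring, abs_mul]
    gcongr
  refine ⟨hE.periodic_velocity, fun x => (hbound x).1, fun x => (hbound x).2, fun x y hd => ?_,
    hE.intervalIntegrable_velocity hA hB⟩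
  rcases le_total x y with h | h
  · exact hlip x y h (by rwa [Set.uIcc_of_le h] at hd)
  · rw [abs_sub_comm, abs_sub_comm x]
    exact hlip y x h (by rwa [Set.uIcc_of_ge h] at hd)

end IsPeriodEnumeration

lemma IsVelocity.integral_inv_pos {L : Set ℝ} {v : ℝ → ℝ} {K : ℝ} (h : IsVelocity L v K)
    (hK : 0 < K) : 0 < ∫ x in (0 : ℝ)..1, (v x)⁻¹ :=
  intervalIntegral.intervalIntegral_pos_of_pos (h.integrable 0 1)
    (fun x => inv_pos.2 (h.pos hK x)) one_pos

end Enumeration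

/-! ### Rotation number of `G_μ` and the final assembly -/

section RotationNumber

variable {n : ℕ} {I : Set ℝ} {b φ : ℤ → ℝ → ℝ} {F : ℝ → CircleDeg1Lift} {μc : ℝ}

lemma CircleDeg1Lift.translationNumber_translate_mul_pow (f : CircleDeg1Lift) (p : ℤ) (q : ℕ) :
    (((translate (Multiplicative.ofAdd (-(p : ℝ))) : CircleDeg1Liftˣ) : CircleDeg1Lift) *
      f ^ q).translationNumber = q * f.translationNumber - p := by
  rw [translationNumber_mul_of_commute, translationNumber_translate, translationNumber_pow]
  · ring
  · rw [commute_iff_commute]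
    intro x
    simp only [translate_apply]
    have := (f ^ q).map_int_add (-p) x
    push_cast at this
    exact this.symm

/-- Evaluated at the right end of a cell, this identifies `A + B d`, `d` the length of the cell, as
a branch speed, hence positive. -/
lemma IsPWLFamily.deriv_branch_eq_add (hF : IsPWLFamily n I b φ F) (hI : IsOpen I)
    (hμc : μc ∈ I) (κ : ℕ → ℤ) (q : ℕ) (l x : ℝ) :
    deriv (fun ν => branch b φ κ q ν x) μc =
      deriv (fun ν => branch b φ κ q ν l) μc + deriv (branchSlope b φ κ q) μc * (x - l) := by
  have h1 := ((hF.contDiffAt_branch (κ := κ) hI hμc q l).differentiableAt two_ne_zero).hasDerivAt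
  have h2 := ((hF.contDiffAt_branchSlope (κ := κ) hI hμc q).differentiableAt
    two_ne_zero).hasDerivAt
  have h3 := h1.add (h2.mul_const (x - l))
  refine (h3.congr_of_eventuallyEq (Eventually.of_forall fun ν => ?_)).deriv
  have := branch_sub_branch b φ κ q ν l x
  simp only [Pi.add_apply]
  linarith

lemma hasDerivAt_of_eventually_abs_sub_le {f : ℝ → ℝ} {c f' R : ℝ}
    (h : ∀ᶠ x in 𝓝[≠] c, |f x - f c - f' * (x - c)| ≤ R * (x - c) ^ 2) : HasDerivAt f f' c := by
  rw [hasDerivAt_iff_isLittleO]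
  have hO : (fun x => f x - f c - (x - c) • f') =O[𝓝 c] fun x => (x - c) ^ 2 := by
    refine IsBigO.of_bound R ?_
    rw [eventually_nhdsWithin_iff] at h
    filter_upwards [h] with x hx
    rcases eq_or_ne x c with rfl | hne
    · simp
    · rw [Real.norm_eq_abs, Real.norm_eq_abs, abs_pow, sq_abs, smul_eq_mul, mul_comm (x - c)]
      exact hx hne
  refine hO.trans_isLittleO ?_
  have : (fun x : ℝ => (x - c) ^ 2) =o[𝓝 c] fun x => (x - c) ^ 1 :=
    ((isLittleO_pow_pow (𝕜 := ℝ) (show 1 < 2 by norm_num)).comp_tendsto (k := fun x : ℝ => x - c)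
      (by simpa using (continuous_sub_right c).tendsto c))
  simpa using this

end RotationNumber

theorem theorem6 (n : ℕ) (I : Set ℝ) (hI : IsOpen I) (b φ : ℤ → ℝ → ℝ) (F : ℝ → CircleDeg1Lift)
    (hF : IsPWLFamily n I b φ F)
    (μc : ℝ) (hμc : μc ∈ I) (p : ℤ) (q : ℕ) (hq : 0 < q)
    (hconj : IsConjugateToRotation (circleMapOfLift (F μc)) ((p : ℝ) / (q : ℝ)))
    (hrot : (F μc).translationNumber = (p : ℝ) / (q : ℝ))
    (htrans : IsTransverse b φ μc) :
    ∃ (N : ℕ) (ℓ A B : ℕ → ℝ) (R₁ : ℝ),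
      IsPeriodEnumeration (breakOrbits (F μc) (fun k => b k μc) q) N ℓ ∧
      (∀ i < N, HasLaminarCoeffs (fun μ x => (F μ ^ q) x - (p : ℝ)) μc (ℓ i) (ℓ (i + 1))
        (A i) (B i)) ∧
      (∀ i < N, 0 < A i ∧ 0 < 1 + (ℓ (i + 1) - ℓ i) * B i / A i) ∧
      R₁ = 1 / ((q : ℝ) * ∑ i ∈ Finset.range N, kappa (ℓ (i + 1) - ℓ i) (A i) (B i)) ∧
      0 < R₁ ∧
      HasDerivAt (fun μ => (F μ).translationNumber) R₁ μc ∧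
      ∃ U : Set ℝ, IsOpen U ∧ μc ∈ U ∧ U ⊆ I ∧ ∃ R₂ : ℝ, 0 < R₂ ∧
        ∀ μ ∈ U, μ ≠ μc →
          |(F μ).translationNumber - (p : ℝ) / (q : ℝ) - R₁ * (μ - μc)| < R₂ * (μ - μc) ^ 2 := by
  have hper := hconj.pow_apply_eq hq hrot
  set L := breakOrbits (F μc) (fun k => b k μc) q
  have hLp : ∀ x, x + 1 ∈ L ↔ x ∈ L := hF.add_one_mem_breakOrbits hμc q
  have hL0 : b 0 μc ∈ L := ⟨0, hq, 0, by simp⟩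
  obtain ⟨N, ℓ, hE⟩ := exists_isPeriodEnumeration hL0 ((hLp _).2 hL0)
    (hF.finite_breakOrbits_inter hμc q _ _)
  have hκ : ∀ i, ∃ κ, i < N → IsPWLFamily.IsItinerary F b μc q (ℓ i) (ℓ (i + 1)) κ := fun i => by
    by_cases hi : i < N
    · obtain ⟨κ, h⟩ := hF.exists_isItinerary hμc (hE.lt_succ hi) (hE.disjoint_Ioo hi)
      exact ⟨κ, fun _ => h⟩
    · exact ⟨0, fun h => absurd h hi⟩
  choose κ hκ using hκ
  set A : ℕ → ℝ := fun i => deriv (fun ν => branch b φ (κ i) q ν (ℓ i)) μc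
  set B : ℕ → ℝ := fun i => deriv (branchSlope b φ (κ i) q) μc
  have hA : ∀ i < N, 0 < A i := fun i hi =>
    (hκ i hi).deriv_branch_pos hF hI hμc htrans hq ⟨le_rfl, (hE.lt_succ hi).le⟩
  have hB : ∀ i < N, 0 < A i + B i * (ℓ (i + 1) - ℓ i) := fun i hi => by
    have := (hκ i hi).deriv_branch_pos hF hI hμc htrans hq ⟨(hE.lt_succ hi).le, le_rfl⟩
    rwa [hF.deriv_branch_eq_add hI hμc (κ i) q (ℓ i)] at this
  have hstep := (eventually_all_finset (Finset.range N)).2 fun i hi =>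
    (hκ i (Finset.mem_range.1 hi)).eventually_abs_step_sub_le hF hI hμc
      (hE.lt_succ (Finset.mem_range.1 hi)) hper
  -- All estimates hold for every large constant, so a single `K` serves as velocity bound, gap
  -- bound, margin and step error.
  obtain ⟨K, hKpos, hV, hgap, hK⟩ := ((eventually_gt_atTop 0).and
    ((hE.eventually_isVelocity hLp hA hB).and
      ((hF.eventually_pow_gap hI hμc htrans hq).and hstep))).exists
  set W := ∑ i ∈ Finset.range N, kappa (ℓ (i + 1) - ℓ i) (A i) (B i) with hW
  have hWint := hE.integral_velocity hA hB
  have hWpos : 0 < W := by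
    rw [hW, ← hWint]
    exact hV.integral_inv_pos hKpos
  have hq' : (0 : ℝ) < q := by exact_mod_cast hq
  set S : Finset ℝ := (hF.finite_breakOrbits_inter hμc q (-1) 2).toFinset with hS
  set C := K ^ 5 + K ^ 2 + 4 * S.card * K ^ 3
  have hsmall : ∀ᶠ μ in 𝓝 μc, 2 * K * |μ - μc| < 1 := by
    refine ContinuousAt.eventually_lt (by fun_prop) (by fun_prop) ?_
    simp
  have hmain : ∀ᶠ μ in 𝓝[≠] μc,
      |(F μ).translationNumber - (p : ℝ) / (q : ℝ) - 1 / (q * W) * (μ - μc)| ≤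
        C / (q * W) * (μ - μc) ^ 2 := by
    filter_upwards [hgap, nhdsWithin_le_nhds ((eventually_all_finset _).2 hK),
      nhdsWithin_le_nhds hsmall, self_mem_nhdsWithin] with μ h1 h2 h3 hne
    have hε : μ - μc ≠ 0 := sub_ne_zero.2 hne
    set g : CircleDeg1Lift := ((CircleDeg1Lift.translate (Multiplicative.ofAdd (-(p : ℝ))) :
      CircleDeg1Liftˣ) : CircleDeg1Lift) * F μ ^ q with hg
    have hgx : ∀ x, g x = (F μ ^ q) x - p := fun x => by
      rw [hg, CircleDeg1Lift.mul_apply, CircleDeg1Lift.translate_apply]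
      ring
    have hgap' : ∀ x, (g x - x) / (μ - μc) ∈ Set.Icc (1 / K) K := fun x => by
      have := h1 x
      rwa [hper, show (F μ ^ q) x - (x + p) = g x - x by rw [hgx]; ring] at this
    have key := hV.abs_translationNumber_mul_sub_le hKpos (hF.countable_breakOrbits hμc q) hLp S
      (by rw [hS, Set.Finite.coe_toFinset]) hε h3.le g (fun x => (hgap' x).1)
      (fun x => (hgap' x).2) (fun x hx => by
        -- Being `K|ε|` away from `L` places `x - m` in the part of its cell where the step estimate
        -- holds.
        obtain ⟨m, i, hi, hxm⟩ := hE.exists_cell x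
        have e1 := hx _ ((add_int_mem_iff hLp _ m).2 (hE.mem hi.le))
        have e2 := hx _ ((add_int_mem_iff hLp _ m).2 (hE.mem (i := i + 1) hi))
        rw [abs_of_nonneg (show 0 ≤ x - (ℓ i + m) by linarith [hxm.1])] at e1
        rw [abs_of_nonpos (show x - (ℓ (i + 1) + m) ≤ 0 by linarith [hxm.2])] at e2
        have := h2 i (Finset.mem_range.2 hi) (x - m) ⟨by linarith, by linarith⟩
        rw [CircleDeg1Lift.map_sub_int] at this
        rw [hE.velocity_eq hi hxm, hgx]
        convert this using 2
        ring)
    rw [hWint, CircleDeg1Lift.translationNumber_translate_mul_pow] at key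
    have e : (F μ).translationNumber - (p : ℝ) / (q : ℝ) - 1 / (q * W) * (μ - μc) =
        1 / (q * W) * ((q * (F μ).translationNumber - p) * W - (μ - μc)) := by
      field_simp
    rw [e, abs_mul, abs_of_pos (by positivity)]
    calc _ ≤ 1 / (q * W) * (C * (μ - μc) ^ 2) := by gcongr
      _ = _ := by ring
  have hCpos : 0 < C := by positivity
  refine ⟨N, ℓ, A, B, 1 / (q * W), hE,
    fun i hi => (hκ i hi).hasLaminarCoeffs hF hI hμc (hE.lt_succ hi) hper,
    fun i hi => ⟨hA i hi, ?_⟩, rfl, by positivity, ?_, ?_⟩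
  · have : 1 + (ℓ (i + 1) - ℓ i) * B i / A i = (A i + B i * (ℓ (i + 1) - ℓ i)) / A i := by
      have := (hA i hi).ne'
      field_simp
    rw [this]
    exact div_pos (hB i hi) (hA i hi)
  · refine hasDerivAt_of_eventually_abs_sub_le (R := C / (q * W)) ?_
    rw [hrot]
    exact hmain
  · obtain ⟨U, hU, hUo, hUc⟩ := eventually_nhds_iff.1 (eventually_nhdsWithin_iff.1 hmain)
    -- The added `1` makes the inequality strict for `μ ≠ μc`.
    refine ⟨U ∩ I, hUo.inter hI, ⟨hUc, hμc⟩, Set.inter_subset_right, C / (q * W) + 1,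
      by positivity, fun μ hμ hne => (hU μ hμ.1 hne).trans_lt ?_⟩
    have : 0 < (μ - μc) ^ 2 := by
      have := sub_ne_zero.2 hne
      positivity
    linarith
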